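/- Let $\mathbb D=\{z\in\mathbb C:|z|<1\}$ and, for $z=x+iy$, let $\partial_z u=\tfrac12(u_x-iu_y)$ and $\overline\partial_z u=\tfrac12(u_x+iu_y)$. For $\alpha>-1$, a complex-valued function $f\in\mathcal C^2(\mathbb D)$ is called $\alpha$-harmonic if $$\partial_z\Big((1-|z|^2)^{-\alpha}\,\overline\partial_z f(z)\Big)=0\qquad\text{for all } z\in\mathbb D.$$ **Theorem.** Let $\alpha>-1$ and let $f:\mathbb D\to\mathbb D$ be an $\alpha$-harmonic function. 1. If $\alpha\ge 0$, then for all $z\in\mathbb D$ $$\left|f(z)-\frac{(1-|z|^2)^{\alpha+1}}{1+|z|^2}f(0)\right|\le\frac{2^{\alpha+2}}{\pi}\arctan|z|+2^{\alpha+1}(1-|z|)\left(1-(1-|z|)^\alpha\right).$$ 2. If $\alpha<0$, then for all $z\in\mathbb D$ $$\left|f(z)-\frac{(1-|z|^2)^{\alpha+1}}{1+|z|^2}f(0)\right|\le\frac4\pi(1-|z|)^\alpha\arctan|z|+\left((1-|z|)^\alpha-1\right).$$ -/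

import Mathlib

/-- The Wirtinger derivative `∂_z u = (u_x - i u_y) / 2` of a complex-valued function of `z = x + i y`. -/
noncomputable def wirtingerD (u : ℂ → ℂ) (z : ℂ) : ℂ :=
  (1 / 2) * (fderiv ℝ u z 1 - Complex.I * fderiv ℝ u z Complex.I)

/-- The conjugate Wirtinger derivative `∂̄_z u = (u_x + i u_y) / 2`. -/
noncomputable def wirtingerDBar (u : ℂ → ℂ) (z : ℂ) : ℂ :=
  (1 / 2) * (fderiv ℝ u z 1 + Complex.I * fderiv ℝ u z Complex.I)

/-- The standard weight `w_α(z) = (1 - |z|²)^α`. -/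
noncomputable def standardWeight (α : ℝ) (z : ℂ) : ℝ := (1 - ‖z‖ ^ 2) ^ α

/-- The weighted Laplacian `Δ_α f = ∂_z (w_α⁻¹ ∂̄_z f)`. -/
noncomputable def weightedLaplacian (α : ℝ) (f : ℂ → ℂ) (z : ℂ) : ℂ :=
  wirtingerD (fun ζ : ℂ => ((standardWeight α ζ)⁻¹ : ℂ) * wirtingerDBar f ζ) z

/-- `f` is `α`-harmonic on the open unit disc: it is twice continuously (real) differentiable there
and satisfies `Δ_α f = 0` there. Values of `f` outside the disc play no role. -/
def IsAlphaHarmonic (α : ℝ) (f : ℂ → ℂ) : Prop :=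
  ContDiffOn ℝ 2 f (Metric.ball 0 1) ∧ ∀ z ∈ Metric.ball (0 : ℂ) 1, weightedLaplacian α f z = 0

/-! With `r = ‖z‖` and `w = z e^{-iθ}`, the function `f` is recovered by averaging its values
against the kernel `P_α(w) = (1 - |w|²)^(α+1) / ((1 - w)(1 - conj w)^(α+1))`. Boundary values are
never constructed: `f z` is the limit, as `ρ → 1⁻`, of the averages of `P_α(z e^{-iθ}) f(ρ e^{iθ})`
(`tendsto_alphaPoissonKernel_mean`).

This representation is obtained mode by mode. Since `∂_z (w_α⁻¹ ∂̄ f) = 0`, the Fourier coefficients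
of `f` on circles satisfy first order equations in the radius. Smoothness at the origin leaves one
free constant per mode, and boundedness of `f` bounds the constants (`exists_boundary_coeff`). The
double power series of `P_α`, grouped by frequency, has exactly the resulting radial profiles
(`hasSum_circleCoeff_mul_exp`).

The zeroth coefficient is constant, so `f 0` is the mean of `f` over each circle. Hence subtracting
`κ f(0)`, with `κ = (1 - r²)^(α+1) / (1 + r²)`, amounts to replacing `P_α` by `P_α - κ`. With `P`
the classical Poisson kernel and `q = (1 - r²)/(1 + r²)`, `P_α - κ = (1 - r²)^α [(1 - conj w)^(-α)
(P - q) + q ((1 - conj w)^(-α) - 1)]`. The integral of `|P - q|` over a period is `8 arctan r`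
(`integral_abs_poissonAngle_sub`), and `(1 - v)^(-α) - 1` is controlled along a segment
(`norm_one_sub_cpow_sub_one_le`). Both cases of the theorem follow from `norm_sub_le_of_bounds` by
inserting size bounds that depend on the sign of `α`. -/

open MeasureTheory Filter Topology Set

/-! ### Fourier coefficients on circles and Wirtinger derivatives. -/

/-- The `k`-th Fourier coefficient of `u` on the circle of radius `ρ` about `0`. -/
noncomputable def circleCoeff (u : ℂ → ℂ) (k : ℤ) (ρ : ℝ) : ℂ :=
  (2 * Real.pi : ℂ)⁻¹ * ∫ θ in (0 : ℝ)..2 * Real.pi,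
    u (ρ * Complex.exp (θ * Complex.I)) * Complex.exp (-(k * θ * Complex.I))

lemma norm_ofReal_mul_exp (ρ θ : ℝ) : ‖(ρ : ℂ) * Complex.exp (θ * Complex.I)‖ = |ρ| := by
  simp [Complex.norm_exp_ofReal_mul_I]

lemma norm_exp_neg_int_mul (k : ℤ) (θ : ℝ) : ‖Complex.exp (-(k * θ * Complex.I))‖ = 1 := by
  have : (-(k * θ * Complex.I) : ℂ) = ((-(k * θ) : ℝ) : ℂ) * Complex.I := by push_cast; ring
  rw [this, Complex.norm_exp_ofReal_mul_I]

lemma ofReal_mul_exp_mem_ball {ρ : ℝ} (hρ : |ρ| < 1) (θ : ℝ) :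
    (ρ : ℂ) * Complex.exp (θ * Complex.I) ∈ Metric.ball (0 : ℂ) 1 := by
  rwa [mem_ball_zero_iff, norm_ofReal_mul_exp]

lemma ContinuousOn.continuous_comp_circle {E : Type*} [TopologicalSpace E] {u : ℂ → E}
    (hu : ContinuousOn u (Metric.ball 0 1)) {ρ : ℝ} (hρ : |ρ| < 1) :
    Continuous fun θ : ℝ => u (ρ * Complex.exp (θ * Complex.I)) :=
  hu.comp_continuous (by fun_prop) (ofReal_mul_exp_mem_ball hρ)

lemma fderiv_apply_eq_wirtinger (u : ℂ → ℂ) (z v : ℂ) :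
    fderiv ℝ u z v = v * wirtingerD u z + (starRingEnd ℂ) v * wirtingerDBar u z := by
  have hv : v = v.re • (1 : ℂ) + v.im • Complex.I := by
    simp [Complex.re_add_im]
  have h1 : fderiv ℝ u z v = v.re * fderiv ℝ u z 1 + v.im * fderiv ℝ u z Complex.I := by
    conv_lhs => rw [hv]
    rw [map_add, map_smul, map_smul, Complex.real_smul, Complex.real_smul]
  have h2 : v = v.re + v.im * Complex.I := (Complex.re_add_im v).symm
  have h3 : (starRingEnd ℂ) v = v.re - v.im * Complex.I := by
    apply Complex.ext <;> simp
  rw [h1, h3]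
  conv_rhs => rw [h2]
  simp only [wirtingerD, wirtingerDBar]
  simp only [Complex.add_re, Complex.ofReal_re, Complex.mul_re, Complex.I_re, Complex.ofReal_im,
    Complex.I_im, Complex.add_im, Complex.mul_im]
  ring_nf
  rw [Complex.I_sq]
  ring

/-- Differentiation under the integral, dominated on a closed disc of radius strictly between `|ρ|`
and `1`. Allowing `ρ ≤ 0` yields continuity at the centre, which later selects the regular
solutions. -/
lemma hasDerivAt_circleCoeff {u : ℂ → ℂ} (hu : ContDiffOn ℝ 1 u (Metric.ball 0 1)) (k : ℤ)
    {ρ : ℝ} (hρ : |ρ| < 1) :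
    HasDerivAt (circleCoeff u k) ((2 * Real.pi : ℂ)⁻¹ * ∫ θ in (0 : ℝ)..2 * Real.pi,
      fderiv ℝ u (ρ * Complex.exp (θ * Complex.I)) (Complex.exp (θ * Complex.I)) *
        Complex.exp (-(k * θ * Complex.I))) ρ := by
  obtain ⟨R, hR, hR1⟩ := exists_between hρ
  have hfd := hu.continuousOn_fderiv_of_isOpen Metric.isOpen_ball le_rfl
  obtain ⟨M, hM⟩ := (isCompact_closedBall (0 : ℂ) R).exists_bound_of_continuousOn
    (hfd.mono (Metric.closedBall_subset_ball hR1))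
  have hs : Ioo (-R) R ∈ 𝓝 ρ := Ioo_mem_nhds (by linarith [neg_abs_le ρ]) (by linarith [le_abs_self ρ])
  have hcont : ∀ x : ℝ, |x| < 1 → Continuous fun θ : ℝ =>
      u (x * Complex.exp (θ * Complex.I)) * Complex.exp (-(k * θ * Complex.I)) := fun x hx =>
    (hu.continuousOn.continuous_comp_circle hx).mul (by fun_prop)
  have hcont' : Continuous fun θ : ℝ =>
      fderiv ℝ u (ρ * Complex.exp (θ * Complex.I)) (Complex.exp (θ * Complex.I)) *
        Complex.exp (-(k * θ * Complex.I)) :=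
    ((hfd.continuous_comp_circle hρ).clm_apply (by fun_prop)).mul (by fun_prop)
  refine HasDerivAt.const_mul _ (intervalIntegral.hasDerivAt_integral_of_dominated_loc_of_deriv_le
    (𝕜 := ℝ) (bound := fun _ => M) (F' := fun x θ =>
      fderiv ℝ u (x * Complex.exp (θ * Complex.I)) (Complex.exp (θ * Complex.I)) *
        Complex.exp (-(k * θ * Complex.I))) hs ?_ ?_ ?_ ?_ ?_ ?_).2
  · filter_upwards [hs] with x hx
    exact (hcont x (lt_trans (abs_lt.2 hx) hR1)).aestronglyMeasurable
  · exact (hcont ρ hρ).intervalIntegrable _ _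
  · exact hcont'.aestronglyMeasurable
  · refine Eventually.of_forall fun θ _ x hx => ?_
    rw [norm_mul, norm_exp_neg_int_mul, mul_one]
    refine (ContinuousLinearMap.le_opNorm _ _).trans ?_
    rw [Complex.norm_exp_ofReal_mul_I, mul_one]
    exact hM _ (by rw [mem_closedBall_zero_iff, norm_ofReal_mul_exp]; exact (abs_lt.2 hx).le)
  · exact intervalIntegrable_const
  · refine Eventually.of_forall fun θ _ x hx => ?_
    have hx1 : |x| < 1 := lt_trans (abs_lt.2 hx) hR1
    have hd : HasFDerivAt u (fderiv ℝ u (x * Complex.exp (θ * Complex.I)))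
        (x * Complex.exp (θ * Complex.I)) :=
      ((hu.differentiableOn one_ne_zero).differentiableAt
        (Metric.isOpen_ball.mem_nhds (ofReal_mul_exp_mem_ball hx1 θ))).hasFDerivAt
    have hl : HasDerivAt (fun x : ℝ => (x : ℂ) * Complex.exp (θ * Complex.I))
        (Complex.exp (θ * Complex.I)) x := by
      simpa using (Complex.ofRealCLM.hasDerivAt (x := x)).mul_const (Complex.exp (θ * Complex.I))
    exact (hd.comp_hasDerivAt x hl).mul_const _

/-- Integration by parts in the angle; the boundary terms cancel by `2π`-periodicity. -/
lemma int_mul_circleCoeff {u : ℂ → ℂ} (hu : ContDiffOn ℝ 1 u (Metric.ball 0 1)) (k : ℤ)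
    {ρ : ℝ} (hρ : |ρ| < 1) :
    (k * Complex.I) * circleCoeff u k ρ = (2 * Real.pi : ℂ)⁻¹ * ∫ θ in (0 : ℝ)..2 * Real.pi,
      fderiv ℝ u (ρ * Complex.exp (θ * Complex.I)) (ρ * Complex.exp (θ * Complex.I) * Complex.I) *
        Complex.exp (-(k * θ * Complex.I)) := by
  have hfd := hu.continuousOn_fderiv_of_isOpen Metric.isOpen_ball le_rfl
  have hc1 : Continuous fun θ : ℝ =>
      fderiv ℝ u (ρ * Complex.exp (θ * Complex.I)) (ρ * Complex.exp (θ * Complex.I) * Complex.I) *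
        Complex.exp (-(k * θ * Complex.I)) :=
    ((hfd.continuous_comp_circle hρ).clm_apply (by fun_prop)).mul (by fun_prop)
  have hc2 : Continuous fun θ : ℝ => u (ρ * Complex.exp (θ * Complex.I)) *
      (Complex.exp (-(k * θ * Complex.I)) * (-(k * Complex.I))) :=
    (hu.continuousOn.continuous_comp_circle hρ).mul (by fun_prop)
  have key : ∫ θ in (0 : ℝ)..2 * Real.pi,
      (fderiv ℝ u (ρ * Complex.exp (θ * Complex.I)) (ρ * Complex.exp (θ * Complex.I) * Complex.I) *
        Complex.exp (-(k * θ * Complex.I)) + u (ρ * Complex.exp (θ * Complex.I)) *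
      (Complex.exp (-(k * θ * Complex.I)) * (-(k * Complex.I)))) = 0 := by
    refine (intervalIntegral.integral_eq_sub_of_hasDerivAt (f := fun θ : ℝ =>
      u (ρ * Complex.exp (θ * Complex.I)) * Complex.exp (-(k * θ * Complex.I)))
      ?_ ((hc1.add hc2).intervalIntegrable _ _)).trans ?_
    swap
    · have e1 : Complex.exp (((2 * Real.pi : ℝ) : ℂ) * Complex.I) = 1 := by
        push_cast; exact Complex.exp_two_pi_mul_I
      have e2 : Complex.exp (-(k * ((2 * Real.pi : ℝ) : ℂ) * Complex.I)) = 1 := by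
        rw [Complex.exp_eq_one_iff]
        exact ⟨-k, by push_cast; ring⟩
      simp only [e1, e2]
      simp
    · intro θ _
      have hd : HasFDerivAt u (fderiv ℝ u (ρ * Complex.exp (θ * Complex.I)))
          (ρ * Complex.exp (θ * Complex.I)) :=
        ((hu.differentiableOn one_ne_zero).differentiableAt
          (Metric.isOpen_ball.mem_nhds (ofReal_mul_exp_mem_ball hρ θ))).hasFDerivAt
      have h0 : HasDerivAt (fun θ : ℝ => (θ : ℂ)) 1 θ := Complex.ofRealCLM.hasDerivAt
      have hl : HasDerivAt (fun θ : ℝ => (ρ : ℂ) * Complex.exp (θ * Complex.I))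
          (ρ * Complex.exp (θ * Complex.I) * Complex.I) θ := by
        have := ((h0.mul_const Complex.I).cexp).const_mul (ρ : ℂ)
        simpa [mul_assoc] using this
      have he : HasDerivAt (fun θ : ℝ => Complex.exp (-(k * θ * Complex.I)))
          (Complex.exp (-(k * θ * Complex.I)) * (-(k * Complex.I))) θ := by
        have := (((h0.const_mul (k : ℂ)).mul_const Complex.I).neg).cexp
        simpa using this
      exact (hd.comp_hasDerivAt θ hl).mul he
  rw [intervalIntegral.integral_add (hc1.intervalIntegrable _ _) (hc2.intervalIntegrable _ _)] at key
  rw [eq_neg_of_add_eq_zero_left key, circleCoeff]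
  simp only [← mul_assoc, intervalIntegral.integral_mul_const]
  ring

/-- In polar form `ρ∂_ρ ± i∂_θ` is `2ρ e^{∓iθ}` times `∂̄` or `∂`. The exponential shifts the
frequency by one, turning Wirtinger equations into ordinary differential equations for the modes. -/
lemma mul_deriv_circleCoeff {u : ℂ → ℂ} (hu : ContDiffOn ℝ 1 u (Metric.ball 0 1)) (k : ℤ)
    {ρ : ℝ} (hρ : |ρ| < 1) :
    ρ * deriv (circleCoeff u k) ρ - k * circleCoeff u k ρ =
      2 * ρ * circleCoeff (wirtingerDBar u) (k + 1) ρ ∧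
    ρ * deriv (circleCoeff u k) ρ + k * circleCoeff u k ρ =
      2 * ρ * circleCoeff (wirtingerD u) (k - 1) ρ := by
  have hfd := hu.continuousOn_fderiv_of_isOpen Metric.isOpen_ball le_rfl
  have hc1 : Continuous fun θ : ℝ =>
      fderiv ℝ u (ρ * Complex.exp (θ * Complex.I)) (ρ * Complex.exp (θ * Complex.I) * Complex.I) *
        Complex.exp (-(k * θ * Complex.I)) :=
    ((hfd.continuous_comp_circle hρ).clm_apply (by fun_prop)).mul (by fun_prop)
  have hc2 : Continuous fun θ : ℝ =>
      fderiv ℝ u (ρ * Complex.exp (θ * Complex.I)) (Complex.exp (θ * Complex.I)) *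
        Complex.exp (-(k * θ * Complex.I)) :=
    ((hfd.continuous_comp_circle hρ).clm_apply (by fun_prop)).mul (by fun_prop)
  have hk : (k : ℂ) * circleCoeff u k ρ = -Complex.I * ((k * Complex.I) * circleCoeff u k ρ) := by
    linear_combination ((k : ℂ) * circleCoeff u k ρ) * Complex.I_sq
  have hconj : ∀ θ : ℝ, (starRingEnd ℂ) (Complex.exp (θ * Complex.I)) =
      Complex.exp (-(θ * Complex.I)) := fun θ => by
    rw [← Complex.exp_conj]; simp
  rw [hk, int_mul_circleCoeff hu k hρ, (hasDerivAt_circleCoeff hu k hρ).deriv]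
  constructor
  · have : ∀ A B c : ℂ, ρ * (c * A) - -Complex.I * (c * B) =
        c * (ρ * A + Complex.I * B) := by intros; ring
    rw [this, ← intervalIntegral.integral_const_mul, ← intervalIntegral.integral_const_mul,
      ← intervalIntegral.integral_add ((hc2.const_mul _).intervalIntegrable _ _)
        ((hc1.const_mul _).intervalIntegrable _ _), circleCoeff, mul_left_comm]
    congr 1
    rw [← intervalIntegral.integral_const_mul]
    refine intervalIntegral.integral_congr fun θ _ => ?_
    simp only [fderiv_apply_eq_wirtinger, map_mul, Complex.conj_ofReal, Complex.conj_I, hconj]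
    have e : Complex.exp (-(((k + 1 : ℤ) : ℂ) * θ * Complex.I)) =
        Complex.exp (-(θ * Complex.I)) * Complex.exp (-(k * θ * Complex.I)) := by
      rw [← Complex.exp_add]; congr 1; push_cast; ring
    rw [e]
    ring_nf
    rw [Complex.I_sq]
    ring
  · have : ∀ A B c : ℂ, ρ * (c * A) + -Complex.I * (c * B) =
        c * (ρ * A + (-Complex.I) * B) := by intros; ring
    rw [this, ← intervalIntegral.integral_const_mul, ← intervalIntegral.integral_const_mul,
      ← intervalIntegral.integral_add ((hc2.const_mul _).intervalIntegrable _ _)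
        ((hc1.const_mul _).intervalIntegrable _ _), circleCoeff, mul_left_comm]
    congr 1
    rw [← intervalIntegral.integral_const_mul]
    refine intervalIntegral.integral_congr fun θ _ => ?_
    simp only [fderiv_apply_eq_wirtinger, map_mul, Complex.conj_ofReal, Complex.conj_I, hconj]
    have e : Complex.exp (-(((k - 1 : ℤ) : ℂ) * θ * Complex.I)) =
        Complex.exp (θ * Complex.I) * Complex.exp (-(k * θ * Complex.I)) := by
      rw [← Complex.exp_add]; congr 1; push_cast; ring
    rw [e]
    ring_nf
    rw [Complex.I_sq]
    ring

lemma circleCoeff_zero_radius (u : ℂ → ℂ) : circleCoeff u 0 0 = u 0 := by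
  simp [circleCoeff, ← mul_assoc, Real.pi_ne_zero]

lemma norm_circleCoeff_le {u : ℂ → ℂ} (hu : ∀ z ∈ Metric.ball (0 : ℂ) 1, ‖u z‖ ≤ 1) (k : ℤ)
    {ρ : ℝ} (hρ : |ρ| < 1) : ‖circleCoeff u k ρ‖ ≤ 1 := by
  have h := intervalIntegral.norm_integral_le_of_norm_le_const (a := 0) (b := 2 * Real.pi) (C := 1)
    (f := fun θ : ℝ => u (ρ * Complex.exp (θ * Complex.I)) * Complex.exp (-(k * θ * Complex.I)))
    fun θ _ => by
      rw [norm_mul, norm_exp_neg_int_mul, mul_one]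
      exact hu _ (ofReal_mul_exp_mem_ball hρ θ)
  have hpi : 0 < 2 * Real.pi := by positivity
  rw [circleCoeff, norm_mul, norm_inv]
  have h2 : ‖(2 * Real.pi : ℂ)‖ = 2 * Real.pi := by
    simp [abs_of_pos Real.pi_pos]
  rw [h2, inv_mul_le_iff₀ hpi]
  simpa [abs_of_pos Real.pi_pos] using h

lemma circleCoeff_congr {u v : ℂ → ℂ} (k : ℤ) {ρ : ℝ}
    (h : ∀ z : ℂ, ‖z‖ = |ρ| → u z = v z) : circleCoeff u k ρ = circleCoeff v k ρ := by
  simp only [circleCoeff]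
  congr 1
  refine intervalIntegral.integral_congr fun θ _ => ?_
  simp only [h _ (norm_ofReal_mul_exp ρ θ)]

/-! ### Binomial coefficients and radial profiles. -/

/-- The coefficients of the power series of `(1 - x) ^ (-(α + 1))`. -/
noncomputable def negBinom (α : ℝ) (n : ℕ) : ℝ := Ring.choose (α + n) n

lemma negBinom_zero (α : ℝ) : negBinom α 0 = 1 := by simp [negBinom]

lemma negBinom_succ (α : ℝ) (n : ℕ) :
    (n + 1) * negBinom α (n + 1) = (α + 1 + n) * negBinom α n := by
  have h := Ring.choose_smul_choose (α + (n + 1 : ℕ)) (n := n + 1) (k := 1) (by omega)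
  simp only [Nat.choose_one_right, Ring.choose_one_right, nsmul_eq_mul, Nat.add_sub_cancel] at h
  rw [negBinom, negBinom]
  push_cast at h ⊢
  rw [h]
  congr 1
  · ring
  · congr 1; ring

lemma negBinom_pos {α : ℝ} (hα : -1 < α) (n : ℕ) : 0 < negBinom α n := by
  induction n with
  | zero => simp [negBinom_zero]
  | succ n ih =>
    have h := negBinom_succ α n
    have h1 : 0 < (α + 1 + n) * negBinom α n := mul_pos (by have := Nat.cast_nonneg (α := ℝ) n; linarith) ih
    rw [← h] at h1
    exact pos_of_mul_pos_right h1 (by positivity)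

lemma hasSum_negBinom (α : ℝ) {z : ℂ} (hz : ‖z‖ < 1) :
    HasSum (fun n => (negBinom α n : ℂ) * z ^ n) (1 / (1 - z) ^ ((α : ℂ) + 1)) := by
  have h := (Complex.one_div_one_sub_cpow_hasFPowerSeriesOnBall_zero ((α : ℂ) + 1)).hasSum
    (y := z) (by
      rw [Metric.mem_eball, edist_zero_right, ← ofReal_norm]
      exact ENNReal.ofReal_lt_one.2 hz)
  simp only [zero_add, FormalMultilinearSeries.ofScalars_apply_eq, smul_eq_mul] at h
  have e : ∀ n : ℕ, Ring.choose ((α : ℂ) + 1 + n - 1) n = negBinom α n := fun n => by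
    rw [negBinom, Complex.ofReal_choose]
    congr 1
    push_cast
    ring
  simpa only [e] using h

/-- The normalized radial factor of the mode `conj z ^ n` of an `α`-harmonic function. -/
noncomputable def radialFactor (α : ℝ) (n : ℕ) (x : ℝ) : ℝ :=
  1 - (1 - x) ^ (α + 1) * ∑ j ∈ Finset.range n, negBinom α j * x ^ j

/-- The full series solves `(1 - x) y' = (α + 1) y`. Truncation leaves a single term, because the
recurrence `negBinom_succ` makes all others telescope. -/
lemma sum_negBinom_ode (α : ℝ) (n : ℕ) (x : ℝ) :
    (1 - x) * (∑ j ∈ Finset.range n, negBinom α j * (j * x ^ (j - 1))) -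
      (α + 1) * ∑ j ∈ Finset.range n, negBinom α j * x ^ j = -(n * negBinom α n * x ^ (n - 1)) := by
  induction n with
  | zero => simp
  | succ n ih =>
    have hx : (n : ℝ) * x ^ (n - 1) * x = n * x ^ n := by
      rcases n with _ | n
      · simp
      · simp [pow_succ, mul_assoc]
    rw [Finset.sum_range_succ, Finset.sum_range_succ, Nat.add_sub_cancel]
    have h := negBinom_succ α n
    push_cast
    linear_combination ih - negBinom α n * hx + x ^ n * h

lemma hasDerivAt_radialFactor (α : ℝ) (n : ℕ) {x : ℝ} (hx : x < 1) :
    HasDerivAt (radialFactor α n) (n * negBinom α n * x ^ (n - 1) * (1 - x) ^ α) x := by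
  have h1 : HasDerivAt (fun x : ℝ => (1 - x) ^ (α + 1)) (-(α + 1) * (1 - x) ^ α) x := by
    have := ((hasDerivAt_id x).const_sub 1).rpow_const (p := α + 1) (Or.inl (by simp; linarith))
    simpa using this
  have h2 : HasDerivAt (fun x : ℝ => ∑ j ∈ Finset.range n, negBinom α j * x ^ j)
      (∑ j ∈ Finset.range n, negBinom α j * (j * x ^ (j - 1))) x :=
    HasDerivAt.fun_sum fun j _ => (hasDerivAt_pow j x).const_mul _
  have h3 : (1 - x) ^ (α + 1) = (1 - x) ^ α * (1 - x) := by
    rw [Real.rpow_add (by linarith), Real.rpow_one]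
  refine ((h1.mul h2).const_sub 1).congr_deriv ?_
  rw [h3]
  linear_combination (-(1 - x) ^ α) * sum_negBinom_ode α n x

lemma tendsto_radialFactor {α : ℝ} (hα : -1 < α) (n : ℕ) :
    Tendsto (fun ρ : ℝ => radialFactor α n (ρ ^ 2)) (𝓝[<] 1) (𝓝 1) := by
  have : ContinuousAt (fun ρ : ℝ => radialFactor α n (ρ ^ 2)) 1 := by
    unfold radialFactor
    refine continuousAt_const.sub (ContinuousAt.mul ?_ (by fun_prop))
    exact ContinuousAt.rpow_const (by fun_prop) (Or.inr (by linarith))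
  have h := this.tendsto.mono_left (nhdsWithin_le_nhds (s := Iio 1))
  have e : radialFactor α n (1 ^ 2) = 1 := by
    simp [radialFactor, Real.zero_rpow (by linarith : α + 1 ≠ 0)]
  rwa [e] at h

/-! ### Solving the equation mode by mode. -/

lemma eq_const_mul_zpow_of_euler {g g' : ℝ → ℂ} (k : ℤ)
    (hg : ∀ ρ ∈ Ioo (0 : ℝ) 1, HasDerivAt g (g' ρ) ρ)
    (h : ∀ ρ ∈ Ioo (0 : ℝ) 1, ρ * g' ρ = k * g ρ) :
    ∃ c : ℂ, ∀ ρ ∈ Ioo (0 : ℝ) 1, g ρ = c * (ρ : ℂ) ^ k := by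
  have hd : ∀ ρ ∈ Ioo (0 : ℝ) 1, HasDerivAt (fun ρ : ℝ => (ρ : ℂ) ^ (-k) * g ρ) 0 ρ := by
    intro ρ hρ
    have h0 : (ρ : ℂ) ≠ 0 := by exact_mod_cast hρ.1.ne'
    have hz : HasDerivAt (fun ρ : ℝ => (ρ : ℂ) ^ (-k)) (((-k : ℤ) : ℂ) * (ρ : ℂ) ^ (-k - 1)) ρ :=
      (hasDerivAt_zpow (-k) (ρ : ℂ) (Or.inl h0)).comp_ofReal
    refine (hz.mul (hg ρ hρ)).congr_deriv ?_
    have h1 := h ρ hρ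
    have e : (ρ : ℂ) ^ (-k) = (ρ : ℂ) ^ (-k - 1) * ρ := by
      rw [← zpow_add_one₀ h0]; congr 1; ring
    rw [e]
    push_cast
    linear_combination (ρ : ℂ) ^ (-k - 1) * h1
  obtain ⟨c, hc⟩ := isOpen_Ioo.exists_is_const_of_deriv_eq_zero isPreconnected_Ioo
    (fun ρ hρ => (hd ρ hρ).differentiableAt.differentiableWithinAt) (fun ρ hρ => (hd ρ hρ).deriv)
  refine ⟨c, fun ρ hρ => ?_⟩
  have h0 : (ρ : ℂ) ≠ 0 := by exact_mod_cast hρ.1.ne'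
  rw [← hc ρ hρ, zpow_neg]
  field_simp

/-- The conjugate-analytic factor `w_α⁻¹ ∂̄ f` of an `α`-harmonic function. -/
noncomputable def weightedDBar (α : ℝ) (f : ℂ → ℂ) (ζ : ℂ) : ℂ :=
  ((standardWeight α ζ)⁻¹ : ℂ) * wirtingerDBar f ζ

lemma one_sub_norm_sq_pos {z : ℂ} (hz : z ∈ Metric.ball (0 : ℂ) 1) : 0 < 1 - ‖z‖ ^ 2 := by
  rw [mem_ball_zero_iff] at hz
  nlinarith [norm_nonneg z]

lemma contDiffOn_weightedDBar (α : ℝ) {f : ℂ → ℂ} (hf : ContDiffOn ℝ 2 f (Metric.ball 0 1)) :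
    ContDiffOn ℝ 1 (weightedDBar α f) (Metric.ball 0 1) := by
  have hfd : ContDiffOn ℝ 1 (fderiv ℝ f) (Metric.ball 0 1) :=
    hf.fderiv_of_isOpen Metric.isOpen_ball (by norm_num)
  have hw : ContDiffOn ℝ 1 (standardWeight α) (Metric.ball 0 1) :=
    ((contDiff_const.sub (contDiff_norm_sq ℝ)).contDiffOn).rpow_const_of_ne
      fun z hz => (one_sub_norm_sq_pos hz).ne'
  have hw' : ContDiffOn ℝ 1 (fun z => (standardWeight α z : ℂ)) (Metric.ball 0 1) :=
    Complex.ofRealCLM.contDiff.comp_contDiffOn hw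
  refine (hw'.inv fun z hz => ?_).mul ?_
  · exact_mod_cast (Real.rpow_pos_of_pos (one_sub_norm_sq_pos hz) α).ne'
  · exact contDiffOn_const.mul ((hfd.clm_apply contDiffOn_const).add
      (contDiffOn_const.mul (hfd.clm_apply contDiffOn_const)))

lemma abs_lt_one_of_mem_Ioo {ρ : ℝ} (hρ : ρ ∈ Ioo (0 : ℝ) 1) : |ρ| < 1 := by
  rw [abs_of_pos hρ.1]; exact hρ.2

lemma circleCoeff_wirtingerDBar (α : ℝ) (f : ℂ → ℂ) (k : ℤ) {ρ : ℝ} (hρ : |ρ| < 1) :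
    circleCoeff (wirtingerDBar f) k ρ =
      ((1 - ρ ^ 2) ^ α : ℝ) * circleCoeff (weightedDBar α f) k ρ := by
  have hpos : 0 < 1 - ρ ^ 2 := by rw [← sq_abs]; nlinarith [abs_nonneg ρ]
  have hne : (((1 - ρ ^ 2) ^ α : ℝ) : ℂ) ≠ 0 := by exact_mod_cast (Real.rpow_pos_of_pos hpos α).ne'
  rw [circleCoeff_congr (u := wirtingerDBar f)
    (v := fun z => (((1 - ρ ^ 2) ^ α : ℝ) : ℂ) * weightedDBar α f z) k]
  · simp only [circleCoeff, mul_assoc, intervalIntegral.integral_const_mul]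
    ring
  · intro z hz
    rw [weightedDBar, standardWeight, hz, sq_abs, mul_inv_cancel_left₀ hne]

/-- `∂_z` annihilates `w_α⁻¹ ∂̄ f`, so each of its modes solves the Euler equation `ρ g' = -m g`. -/
lemma circleCoeff_weightedDBar {α : ℝ} {f : ℂ → ℂ} (hf : IsAlphaHarmonic α f) (m : ℤ) :
    ∃ c : ℂ, ∀ ρ ∈ Ioo (0 : ℝ) 1, circleCoeff (weightedDBar α f) m ρ = c * (ρ : ℂ) ^ (-m) := by
  have hG := contDiffOn_weightedDBar α hf.1
  refine eq_const_mul_zpow_of_euler (-m)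
    (fun ρ hρ => (hasDerivAt_circleCoeff hG m (abs_lt_one_of_mem_Ioo hρ)).differentiableAt.hasDerivAt)
    fun ρ hρ => ?_
  have h1 := (mul_deriv_circleCoeff hG m (abs_lt_one_of_mem_Ioo hρ)).2
  have h2 : circleCoeff (wirtingerD (weightedDBar α f)) (m - 1) ρ = 0 := by
    rw [circleCoeff_congr (v := fun _ => 0)]
    · simp [circleCoeff]
    · intro z hz
      exact hf.2 z (by rw [mem_ball_zero_iff, hz]; exact abs_lt_one_of_mem_Ioo hρ)
  rw [h2] at h1
  push_cast
  linear_combination h1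

lemma tendsto_circleCoeff_zero {u : ℂ → ℂ} (hu : ContDiffOn ℝ 1 u (Metric.ball 0 1)) (k : ℤ) :
    Tendsto (circleCoeff u k) (𝓝[>] 0) (𝓝 (circleCoeff u k 0)) :=
  (hasDerivAt_circleCoeff hu k (by simp)).continuousAt.tendsto.mono_left nhdsWithin_le_nhds

lemma eventually_mem_Ioo_nhdsGT_zero : ∀ᶠ ρ : ℝ in 𝓝[>] 0, ρ ∈ Ioo (0 : ℝ) 1 :=
  Ioo_mem_nhdsGT one_pos

lemma tendsto_pow_mul_circleCoeff {u : ℂ → ℂ} (hu : ContDiffOn ℝ 1 u (Metric.ball 0 1)) (k : ℤ)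
    (n : ℕ) : Tendsto (fun ρ : ℝ => (ρ : ℂ) ^ (n + 1) * circleCoeff u k ρ) (𝓝[>] 0) (𝓝 0) := by
  have h1 : Tendsto (fun ρ : ℝ => (ρ : ℂ) ^ (n + 1)) (𝓝[>] 0) (𝓝 0) := by
    have : Continuous fun ρ : ℝ => (ρ : ℂ) ^ (n + 1) := by fun_prop
    simpa using (this.tendsto 0).mono_left (nhdsWithin_le_nhds (s := Ioi 0))
  simpa using h1.mul (tendsto_circleCoeff_zero hu k)

/-- A negative power of `ρ` would blow up at the origin, where the coefficient stays continuous; its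
constant must vanish. -/
lemma circleCoeff_weightedDBar_eq_zero {α : ℝ} {f : ℂ → ℂ} (hf : IsAlphaHarmonic α f) (n : ℕ)
    {ρ : ℝ} (hρ : ρ ∈ Ioo (0 : ℝ) 1) : circleCoeff (weightedDBar α f) (n + 1) ρ = 0 := by
  obtain ⟨c, hc⟩ := circleCoeff_weightedDBar hf (n + 1)
  have h := tendsto_pow_mul_circleCoeff (contDiffOn_weightedDBar α hf.1) (n + 1) n
  have h2 : Tendsto (fun ρ : ℝ => (ρ : ℂ) ^ (n + 1) * circleCoeff (weightedDBar α f) (n + 1) ρ)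
      (𝓝[>] 0) (𝓝 c) := by
    refine tendsto_const_nhds.congr' ?_
    filter_upwards [eventually_mem_Ioo_nhdsGT_zero] with ρ hρ
    have h0 : (ρ : ℂ) ≠ 0 := by exact_mod_cast hρ.1.ne'
    have e : (ρ : ℂ) ^ ((n : ℤ) + 1) = (ρ : ℂ) ^ (n + 1) := by norm_cast
    rw [hc ρ hρ, zpow_neg, e]
    field_simp
  rw [hc ρ hρ, tendsto_nhds_unique h2 h, zero_mul]

lemma circleCoeff_natCast {α : ℝ} {f : ℂ → ℂ} (hf : IsAlphaHarmonic α f) (n : ℕ) :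
    ∃ c : ℂ, ∀ ρ ∈ Ioo (0 : ℝ) 1, circleCoeff f n ρ = c * (ρ : ℂ) ^ n := by
  have hf1 : ContDiffOn ℝ 1 f (Metric.ball 0 1) := hf.1.of_le (by norm_num)
  obtain ⟨c, hc⟩ := eq_const_mul_zpow_of_euler (g := circleCoeff f n) n
    (fun ρ hρ => (hasDerivAt_circleCoeff hf1 n (abs_lt_one_of_mem_Ioo hρ)).differentiableAt.hasDerivAt)
    fun ρ hρ => by
      have h1 := (mul_deriv_circleCoeff hf1 n (abs_lt_one_of_mem_Ioo hρ)).1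
      rw [circleCoeff_wirtingerDBar α f _ (abs_lt_one_of_mem_Ioo hρ),
        circleCoeff_weightedDBar_eq_zero hf n hρ] at h1
      linear_combination h1
  exact ⟨c, fun ρ hρ => by simpa using hc ρ hρ⟩

/-- The mode equation makes the derivative of `ρ^(n+1) f_{-(n+1)}` a multiple of `ρ^(2n+1) (1 -
ρ²)^α`, which is the derivative of the radial profile in `ρ²` up to a constant. -/
lemma circleCoeff_neg_natCast {α : ℝ} (hα : -1 < α) {f : ℂ → ℂ} (hf : IsAlphaHarmonic α f) (n : ℕ) :
    ∃ c : ℂ, ∀ ρ ∈ Ioo (0 : ℝ) 1, (ρ : ℂ) ^ (n + 1) * circleCoeff f (-(n + 1 : ℕ)) ρ =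
      c * radialFactor α (n + 1) (ρ ^ 2) := by
  have hf1 : ContDiffOn ℝ 1 f (Metric.ball 0 1) := hf.1.of_le (by norm_num)
  obtain ⟨β, hβ⟩ := circleCoeff_weightedDBar hf (-n)
  have hb : (((n + 1 : ℕ) * negBinom α (n + 1) : ℝ) : ℂ) ≠ 0 := by
    exact_mod_cast (mul_pos (by positivity) (negBinom_pos hα (n + 1))).ne'
  set b : ℂ := (((n + 1 : ℕ) * negBinom α (n + 1) : ℝ) : ℂ) with hbdef
  have hsq : ∀ ρ ∈ Ioo (0 : ℝ) 1, ρ ^ 2 < 1 := fun ρ hρ => by nlinarith [hρ.1, hρ.2]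
  have hd : ∀ ρ ∈ Ioo (0 : ℝ) 1, HasDerivAt (fun ρ : ℝ => (ρ : ℂ) ^ (n + 1) *
      circleCoeff f (-(n + 1 : ℕ)) ρ - β / b * radialFactor α (n + 1) (ρ ^ 2)) 0 ρ := by
    intro ρ hρ
    have hA := (hasDerivAt_circleCoeff hf1 (-(n + 1 : ℕ))
      (abs_lt_one_of_mem_Ioo hρ)).differentiableAt.hasDerivAt
    have hp : HasDerivAt (fun ρ : ℝ => (ρ : ℂ) ^ (n + 1)) (((n + 1 : ℕ) : ℂ) * (ρ : ℂ) ^ n) ρ := by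
      simpa using (hasDerivAt_pow (n + 1) (ρ : ℂ)).comp_ofReal
    have hΦ := (((hasDerivAt_radialFactor α (n + 1) (hsq ρ hρ)).comp (h := fun ρ : ℝ => ρ ^ 2) ρ
      (hasDerivAt_pow 2 ρ)).ofReal_comp).const_mul (β / b)
    refine ((hp.mul hA).sub hΦ).congr_deriv ?_
    have h1 := (mul_deriv_circleCoeff hf1 (-(n + 1 : ℕ)) (abs_lt_one_of_mem_Ioo hρ)).1
    have e : (-((n + 1 : ℕ) : ℤ) + 1) = -(n : ℤ) := by push_cast; ring
    rw [e, circleCoeff_wirtingerDBar α f _ (abs_lt_one_of_mem_Ioo hρ), hβ ρ hρ, neg_neg,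
      zpow_natCast] at h1
    have e2 : (((((n + 1 : ℕ) : ℝ) * negBinom α (n + 1) * (ρ ^ 2) ^ (n + 1 - 1) * (1 - ρ ^ 2) ^ α) *
        (((2 : ℕ) : ℝ) * ρ ^ (2 - 1)) : ℝ) : ℂ) =
        b * (((1 - ρ ^ 2) ^ α : ℝ) : ℂ) * 2 * (ρ : ℂ) ^ n * (ρ : ℂ) ^ n * ρ := by
      rw [hbdef]
      simp only [Nat.add_sub_cancel]
      push_cast
      ring
    rw [e2]
    push_cast at h1 ⊢
    field_simp
    linear_combination (ρ : ℂ) ^ n * h1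
  obtain ⟨c, hc⟩ := isOpen_Ioo.exists_is_const_of_deriv_eq_zero isPreconnected_Ioo
    (fun ρ hρ => (hd ρ hρ).differentiableAt.differentiableWithinAt) (fun ρ hρ => (hd ρ hρ).deriv)
  -- The integration constant is read off at `ρ → 0`: both terms vanish there, since the index `n +
  -- 1` is positive.
  have hc0 : c = 0 := by
    have h1 := tendsto_pow_mul_circleCoeff hf1 (-(n + 1 : ℕ)) n
    have h2 : Tendsto (fun ρ : ℝ => β / b * (radialFactor α (n + 1) (ρ ^ 2) : ℂ)) (𝓝[>] 0) (𝓝 0) := by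
      have hcont : ContinuousAt (fun ρ : ℝ => radialFactor α (n + 1) (ρ ^ 2)) 0 :=
        ContinuousAt.comp (f := fun ρ : ℝ => ρ ^ 2)
          (hasDerivAt_radialFactor α (n + 1) (by norm_num)).continuousAt (by fun_prop)
      have h0 : radialFactor α (n + 1) (0 ^ 2) = 0 := by
        simp [radialFactor, Finset.sum_range_succ', negBinom_zero]
      have := ((Complex.continuous_ofReal.tendsto _).comp
        (hcont.tendsto.mono_left (nhdsWithin_le_nhds (s := Ioi 0)))).const_mul (β / b)
      rw [h0] at this
      simpa [Function.comp_def] using this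
    have h3 := h1.sub h2
    rw [sub_zero] at h3
    refine tendsto_nhds_unique (tendsto_const_nhds.congr' ?_) h3
    filter_upwards [eventually_mem_Ioo_nhdsGT_zero] with ρ hρ
    exact (hc ρ hρ).symm
  refine ⟨β / b, fun ρ hρ => ?_⟩
  have := hc ρ hρ
  rw [hc0] at this
  exact sub_eq_zero.1 this

/-- The Fourier coefficients of a bounded `α`-harmonic function have limits at the unit circle, and
are determined by them. -/
lemma exists_boundary_coeff {α : ℝ} (hα : -1 < α) {f : ℂ → ℂ} (hf : IsAlphaHarmonic α f)
    (hbd : ∀ z ∈ Metric.ball (0 : ℂ) 1, ‖f z‖ ≤ 1) :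
    ∃ c : ℤ → ℂ, (∀ k, ‖c k‖ ≤ 1) ∧
      (∀ k, Tendsto (circleCoeff f k) (𝓝[<] 1) (𝓝 (c k))) ∧
      (∀ n : ℕ, ∀ ρ ∈ Ioo (0 : ℝ) 1, circleCoeff f n ρ = c n * (ρ : ℂ) ^ n) ∧
      (∀ n : ℕ, ∀ ρ ∈ Ioo (0 : ℝ) 1, (ρ : ℂ) ^ n * circleCoeff f (-n) ρ =
        c (-n) * radialFactor α n (ρ ^ 2)) := by
  have hev : ∀ᶠ ρ : ℝ in 𝓝[<] 1, ρ ∈ Ioo (0 : ℝ) 1 := Ioo_mem_nhdsLT one_pos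
  have hpow : ∀ n : ℕ, Tendsto (fun ρ : ℝ => (ρ : ℂ) ^ n) (𝓝[<] 1) (𝓝 1) := fun n => by
    have : Continuous fun ρ : ℝ => (ρ : ℂ) ^ n := by fun_prop
    simpa using (this.tendsto 1).mono_left (nhdsWithin_le_nhds (s := Iio 1))
  have hnat : ∀ n : ℕ, ∃ c : ℂ, Tendsto (circleCoeff f n) (𝓝[<] 1) (𝓝 c) ∧
      ∀ ρ ∈ Ioo (0 : ℝ) 1, circleCoeff f n ρ = c * (ρ : ℂ) ^ n := fun n => by
    obtain ⟨c, hc⟩ := circleCoeff_natCast hf n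
    refine ⟨c, ?_, hc⟩
    have := (hpow n).const_mul c
    rw [mul_one] at this
    refine this.congr' ?_
    filter_upwards [hev] with ρ hρ using (hc ρ hρ).symm
  have hneg : ∀ n : ℕ, ∃ c : ℂ, Tendsto (circleCoeff f (-(n + 1 : ℕ))) (𝓝[<] 1) (𝓝 c) ∧
      ∀ ρ ∈ Ioo (0 : ℝ) 1, (ρ : ℂ) ^ (n + 1) * circleCoeff f (-(n + 1 : ℕ)) ρ =
        c * radialFactor α (n + 1) (ρ ^ 2) := fun n => by
    obtain ⟨c, hc⟩ := circleCoeff_neg_natCast hα hf n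
    refine ⟨c, ?_, hc⟩
    have h1 := (((Complex.continuous_ofReal.tendsto _).comp
      (tendsto_radialFactor hα (n + 1))).const_mul c).mul ((hpow (n + 1)).inv₀ one_ne_zero)
    simp only [Complex.ofReal_one, mul_one, inv_one] at h1
    refine h1.congr' ?_
    filter_upwards [hev] with ρ hρ
    have h0 : (ρ : ℂ) ≠ 0 := by exact_mod_cast hρ.1.ne'
    simp only [Function.comp_apply]
    rw [← hc ρ hρ]
    field_simp
  choose p hp hp' using hnat
  choose q hq hq' using hneg
  -- The two families are glued along the constructors of `ℤ`; `Int.negSucc n` is `-(n + 1)`, which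
  -- explains the shifted index in `hneg`.
  have hlim : ∀ k : ℤ, Tendsto (circleCoeff f k) (𝓝[<] 1)
      (𝓝 ((fun k : ℤ => Int.casesOn k p q : ℤ → ℂ) k)) := fun k => by
    cases k with
    | ofNat n => exact hp n
    | negSucc n => exact hq n
  refine ⟨fun k => Int.casesOn k p q, fun k => ?_, hlim, hp', ?_⟩
  · refine le_of_tendsto (hlim k).norm ?_
    filter_upwards [hev] with ρ hρ using norm_circleCoeff_le hbd k (abs_lt_one_of_mem_Ioo hρ)
  · rintro (_ | n) ρ hρ
    · simp only [radialFactor, Finset.range_zero, Finset.sum_empty, mul_zero, sub_zero,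
        Complex.ofReal_one, mul_one, pow_zero, one_mul]
      exact (hp' 0 ρ hρ).trans (by rw [pow_zero, mul_one]; rfl)
    · exact hq' n ρ hρ

/-! ### Series expansion of the kernel and the Poisson representation. -/

/-- The Poisson kernel for `α`-harmonic functions. -/
noncomputable def alphaPoissonKernel (α : ℝ) (w : ℂ) : ℂ :=
  ((1 - ‖w‖ ^ 2) ^ (α + 1) : ℝ) *
    (1 / (1 - w) * (1 / (1 - (starRingEnd ℂ) w) ^ ((α : ℂ) + 1)))

/-- The monomials `b_j z^i (conj z)^j` of the double power series of the Poisson kernel. -/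
noncomputable def kernelTerm (α : ℝ) (z : ℂ) (p : ℕ × ℕ) : ℂ :=
  z ^ p.1 * (negBinom α p.2 * (starRingEnd ℂ) z ^ p.2)

lemma norm_kernelTerm_rotate (α : ℝ) (z : ℂ) (p : ℕ × ℕ) {ζ : ℂ} (hζ : ‖ζ‖ = 1) :
    ‖kernelTerm α (z * ζ) p‖ = ‖kernelTerm α z p‖ := by
  simp [kernelTerm, hζ]

lemma summable_norm_kernelTerm (α : ℝ) {z : ℂ} (hz : ‖z‖ < 1) :
    Summable fun p => ‖kernelTerm α z p‖ := by
  refine Summable.mul_norm (f := fun i : ℕ => z ^ i)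
    (g := fun j : ℕ => (negBinom α j : ℂ) * (starRingEnd ℂ) z ^ j) ?_ ?_
  · simpa using summable_geometric_of_lt_one (norm_nonneg z) hz
  · exact (hasSum_negBinom α (z := (starRingEnd ℂ) z) (by simpa using hz)).summable.norm

lemma hasSum_kernelTerm (α : ℝ) {z : ℂ} (hz : ‖z‖ < 1) :
    HasSum (kernelTerm α z) (1 / (1 - z) * (1 / (1 - (starRingEnd ℂ) z) ^ ((α : ℂ) + 1))) := by
  refine HasSum.mul (f := fun i : ℕ => z ^ i)
    (g := fun j : ℕ => (negBinom α j : ℂ) * (starRingEnd ℂ) z ^ j) ?_ ?_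
    (summable_norm_kernelTerm α hz).of_norm
  · simpa using hasSum_geometric_of_norm_lt_one hz
  · exact hasSum_negBinom α (by simpa using hz)

/-- The profile is `(1 - x)^(α+1)` times the tail of the binomial series from degree `n` on, as the
full series sums to `(1 - x)^(-(α+1))`. -/
lemma hasSum_radialFactor (α : ℝ) (n : ℕ) {x : ℝ} (hx : |x| < 1) :
    HasSum (fun m => (((1 - x) ^ (α + 1) : ℝ) : ℂ) * (negBinom α (m + n) * (x : ℂ) ^ (m + n)))
      (radialFactor α n x) := by
  have h1x : 0 < 1 - x := by linarith [le_abs_self x]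
  have hne : (((1 - x) ^ (α + 1) : ℝ) : ℂ) ≠ 0 := by
    exact_mod_cast (Real.rpow_pos_of_pos h1x _).ne'
  have h := ((hasSum_nat_add_iff' n).2 (hasSum_negBinom α (z := (x : ℂ)) (by simpa using hx))).mul_left
    (((1 - x) ^ (α + 1) : ℝ) : ℂ)
  have e : (1 - (x : ℂ)) ^ ((α : ℂ) + 1) = (((1 - x) ^ (α + 1) : ℝ) : ℂ) := by
    rw [Complex.ofReal_cpow h1x.le]
    push_cast
    rfl
  rw [e, mul_sub, mul_one_div_cancel hne] at h
  have e2 : (radialFactor α n x : ℂ) = 1 - (((1 - x) ^ (α + 1) : ℝ) : ℂ) *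
      ∑ j ∈ Finset.range n, (negBinom α j : ℂ) * (x : ℂ) ^ j := by
    simp only [radialFactor, Complex.ofReal_sub, Complex.ofReal_one, Complex.ofReal_mul,
      Complex.ofReal_sum, Complex.ofReal_pow]
  rw [e2]
  exact h

/-- Reindexing of `ℕ × ℕ` by the difference and the minimum of the two entries. -/
def intProdNatEquiv : ℤ × ℕ ≃ ℕ × ℕ where
  toFun p := (p.1.toNat + p.2, (-p.1).toNat + p.2)
  invFun p := ((p.1 : ℤ) - p.2, min p.1 p.2)
  left_inv p := by
    rcases p with ⟨k, m⟩
    simp only [Prod.mk.injEq]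
    omega
  right_inv p := by
    rcases p with ⟨i, j⟩
    simp only [Prod.mk.injEq]
    omega

lemma mul_conj_pow (z : ℂ) (m : ℕ) : z ^ m * (starRingEnd ℂ) z ^ m = ((‖z‖ ^ 2 : ℝ) : ℂ) ^ m := by
  rw [← mul_pow, Complex.mul_conj, Complex.normSq_eq_norm_sq]

/-- The kernel series converges absolutely, so it may be summed along the fibres of `(i, j) ↦ i -
j`. On a fibre the terms differ by powers of `r²`, and their sum is a binomial tail, hence a radial
profile. -/
lemma hasSum_circleCoeff_mul_exp {α : ℝ} {f : ℂ → ℂ} {c : ℤ → ℂ} (hbd : ∀ k, ‖c k‖ ≤ 1)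
    (hpos : ∀ n : ℕ, ∀ ρ ∈ Ioo (0 : ℝ) 1, circleCoeff f n ρ = c n * (ρ : ℂ) ^ n)
    (hneg : ∀ n : ℕ, ∀ ρ ∈ Ioo (0 : ℝ) 1, (ρ : ℂ) ^ n * circleCoeff f (-n) ρ =
      c (-n) * radialFactor α n (ρ ^ 2)) {r : ℝ} (hr : r ∈ Ioo (0 : ℝ) 1) (t : ℝ) :
    HasSum (fun k : ℤ => circleCoeff f k r * Complex.exp (k * t * Complex.I))
      ((((1 - r ^ 2) ^ (α + 1) : ℝ) : ℂ) * ∑' p : ℕ × ℕ,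
        kernelTerm α (r * Complex.exp (t * Complex.I)) p * c ((p.1 : ℤ) - p.2)) := by
  set z : ℂ := r * Complex.exp (t * Complex.I) with hzdef
  have hzn : ‖z‖ = r := by rw [hzdef, norm_ofReal_mul_exp, abs_of_pos hr.1]
  have hr0 : (r : ℂ) ≠ 0 := by exact_mod_cast hr.1.ne'
  have hr2 : |r ^ 2| < 1 := by
    rw [abs_of_nonneg (sq_nonneg r)]; nlinarith [hr.1, hr.2]
  have hsum : Summable fun p : ℕ × ℕ => kernelTerm α z p * c ((p.1 : ℤ) - p.2) := by
    refine Summable.of_norm_bounded (summable_norm_kernelTerm α (z := z) (by rw [hzn]; exact hr.2))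
      fun p => ?_
    rw [norm_mul]
    exact mul_le_of_le_one_right (norm_nonneg _) (hbd _)
  have h1 := (intProdNatEquiv.hasSum_iff.2 hsum.hasSum).mul_left (((1 - r ^ 2) ^ (α + 1) : ℝ) : ℂ)
  refine h1.prod_fiberwise fun k => ?_
  simp only [Function.comp_apply, intProdNatEquiv, Equiv.coe_fn_mk, kernelTerm]
  obtain ⟨n, rfl | rfl⟩ := k.eq_nat_or_neg
  · have h2 := (hasSum_radialFactor α 0 hr2).mul_left (z ^ n * c n)
    have e : circleCoeff f n r * Complex.exp (((n : ℤ) : ℂ) * t * Complex.I) =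
        z ^ n * c n * radialFactor α 0 (r ^ 2) := by
      rw [hpos n r hr, hzdef, mul_pow, ← Complex.exp_nat_mul, radialFactor]
      push_cast
      simp only [Finset.range_zero, Finset.sum_empty, mul_zero, sub_zero, mul_one]
      rw [mul_assoc (n : ℂ)]
      ring
    rw [e]
    refine (congrArg (HasSum · _) (funext fun m => ?_)).mp h2
    have h3 := mul_conj_pow z m
    rw [hzn] at h3
    have e1 : ((n : ℤ)).toNat = n := by simp
    have e2 : (-(n : ℤ)).toNat = 0 := by omega
    rw [e1, e2]
    simp only [zero_add, add_zero]
    rw [← h3]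
    have e4 : ((n + m : ℕ) : ℤ) - (m : ℕ) = n := by push_cast; ring
    rw [e4, pow_add]
    ring
  -- The tail carries `r^(2(m+n))`, whereas the diagonal part of a fibre term is only `r^(2m)`; the
  -- factor `(r^(2n))⁻¹` removes the excess.
  · have h2 := (hasSum_radialFactor α n hr2).mul_left
      ((starRingEnd ℂ) z ^ n * c (-n) * ((r : ℂ) ^ (2 * n))⁻¹)
    have hconj : (starRingEnd ℂ) z = r * Complex.exp (-(t * Complex.I)) := by
      rw [hzdef, map_mul, Complex.conj_ofReal, ← Complex.exp_conj]; simp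
    have e : circleCoeff f (-(n : ℤ)) r * Complex.exp (((-(n : ℤ) : ℤ) : ℂ) * t * Complex.I) =
        (starRingEnd ℂ) z ^ n * c (-n) * ((r : ℂ) ^ (2 * n))⁻¹ * radialFactor α n (r ^ 2) := by
      have h3 := hneg n r hr
      have e3 : Complex.exp (((-(n : ℤ) : ℤ) : ℂ) * t * Complex.I) =
          Complex.exp (-(t * Complex.I)) ^ n := by
        rw [← Complex.exp_nat_mul]; congr 1; push_cast; ring
      rw [e3, hconj, mul_pow, two_mul, pow_add]
      field_simp
      linear_combination h3
    rw [e]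
    refine (congrArg (HasSum · _) (funext fun m => ?_)).mp h2
    have h3 := mul_conj_pow z m
    rw [hzn] at h3
    have e1 : (-(n : ℤ)).toNat = 0 := by omega
    have e2 : (- -(n : ℤ)).toNat = n := by omega
    rw [e1, e2]
    simp only [zero_add]
    have e4 : ((m : ℕ) : ℤ) - (n + m : ℕ) = -n := by push_cast; ring
    have e5 : (((r ^ 2 : ℝ) : ℂ)) ^ (m + n) = ((r ^ 2 : ℝ) : ℂ) ^ m * (r : ℂ) ^ (2 * n) := by
      rw [pow_add, pow_mul]; push_cast; rfl
    rw [e4, e5, ← h3, pow_add, add_comm n m]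
    field_simp

/-- Convergence of the series in `ℂ` is absolute, so the Fourier coefficients are summable, and a
continuous function on the circle then equals its Fourier series pointwise. -/
lemma eq_series_of_continuousOn {f : ℂ → ℂ} (hf : ContinuousOn f (Metric.ball 0 1)) {r : ℝ}
    (hr : |r| < 1) (t : ℝ) {s : ℂ}
    (h : HasSum (fun k : ℤ => circleCoeff f k r * Complex.exp (k * t * Complex.I)) s) :
    s = f (r * Complex.exp (t * Complex.I)) := by
  have : Fact (0 < 2 * Real.pi) := ⟨Real.two_pi_pos⟩
  let g : C(AddCircle (2 * Real.pi), ℂ) :=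
    ⟨fun x => f (r * (AddCircle.toCircle x : ℂ)), hf.comp_continuous
      (continuous_const.mul (continuous_subtype_val.comp AddCircle.continuous_toCircle))
      fun x => by simpa [Circle.norm_coe] using hr⟩
  have hpi : (Real.pi : ℂ) ≠ 0 := by exact_mod_cast Real.pi_ne_zero
  have hg : ∀ θ : ℝ, g (θ : AddCircle (2 * Real.pi)) = f (r * Complex.exp (θ * Complex.I)) := by
    intro θ
    simp only [g, ContinuousMap.coe_mk, AddCircle.toCircle_apply_mk, Circle.coe_exp]
    congr 4
    push_cast
    field_simp
  have hfo : ∀ (k : ℤ) (θ : ℝ), fourier k (θ : AddCircle (2 * Real.pi)) =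
      Complex.exp (k * θ * Complex.I) := by
    intro k θ
    rw [fourier_coe_apply]
    congr 1
    push_cast
    field_simp
  have hcoeff : ∀ k, fourierCoeff g k = circleCoeff f k r := by
    intro k
    rw [fourierCoeff_eq_intervalIntegral _ _ 0, circleCoeff, zero_add, Complex.real_smul]
    congr 1
    · push_cast; simp
    · refine intervalIntegral.integral_congr fun θ _ => ?_
      simp only [hg, hfo, smul_eq_mul]
      rw [mul_comm]
      congr 2
      push_cast
      ring
  have hs : Summable (fourierCoeff g) := by
    refine Summable.of_norm (h.summable.norm.congr fun k => ?_)
    rw [norm_mul, hcoeff]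
    have : (k * t * Complex.I : ℂ) = ((k * t : ℝ) : ℂ) * Complex.I := by push_cast; ring
    rw [this, Complex.norm_exp_ofReal_mul_I, mul_one]
  have h1 := has_pointwise_sum_fourier_series_of_summable hs (t : AddCircle (2 * Real.pi))
  simp only [hcoeff, hfo, smul_eq_mul, hg] at h1
  exact h.unique h1

lemma kernelTerm_mul_exp (α : ℝ) (z : ℂ) (p : ℕ × ℕ) (θ : ℝ) :
    kernelTerm α (z * Complex.exp (-(θ * Complex.I))) p =
      kernelTerm α z p * Complex.exp (-((((p.1 : ℤ) - p.2 : ℤ) : ℂ) * θ * Complex.I)) := by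
  have hconj : (starRingEnd ℂ) (Complex.exp (-(θ * Complex.I))) = Complex.exp (θ * Complex.I) := by
    rw [← Complex.exp_conj]; simp
  have e : Complex.exp (-((((p.1 : ℤ) - p.2 : ℤ) : ℂ) * θ * Complex.I)) =
      Complex.exp (-(θ * Complex.I)) ^ p.1 * Complex.exp (θ * Complex.I) ^ p.2 := by
    rw [← Complex.exp_nat_mul, ← Complex.exp_nat_mul, ← Complex.exp_add]
    congr 1; push_cast; ring
  rw [kernelTerm, kernelTerm, map_mul, hconj, e, mul_pow, mul_pow]
  ring

lemma norm_exp_neg_mul_I (θ : ℝ) : ‖Complex.exp (-(θ * Complex.I))‖ = 1 := by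
  have : (-(θ * Complex.I) : ℂ) = ((-θ : ℝ) : ℂ) * Complex.I := by push_cast; ring
  rw [this, Complex.norm_exp_ofReal_mul_I]

/-- Termwise integration of the kernel series, dominated by the norms of its terms, which do not
change under rotation. -/
lemma alphaPoissonKernel_mean (α : ℝ) {f : ℂ → ℂ} (hf : ContinuousOn f (Metric.ball 0 1))
    (hbd : ∀ z ∈ Metric.ball (0 : ℂ) 1, ‖f z‖ ≤ 1) {z : ℂ} (hz : ‖z‖ < 1) {ρ : ℝ} (hρ : |ρ| < 1) :
    (2 * Real.pi : ℂ)⁻¹ * ∫ θ in (0 : ℝ)..2 * Real.pi,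
      alphaPoissonKernel α (z * Complex.exp (-(θ * Complex.I))) *
        f (ρ * Complex.exp (θ * Complex.I)) =
    (((1 - ‖z‖ ^ 2) ^ (α + 1) : ℝ) : ℂ) *
      ∑' p : ℕ × ℕ, kernelTerm α z p * circleCoeff f ((p.1 : ℤ) - p.2) ρ := by
  have hzn : ∀ θ : ℝ, ‖z * Complex.exp (-(θ * Complex.I))‖ = ‖z‖ := fun θ => by
    rw [norm_mul, norm_exp_neg_mul_I, mul_one]
  have h := intervalIntegral.hasSum_integral_of_dominated_convergence (a := 0) (b := 2 * Real.pi)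
    (μ := volume) (fun p _ => ‖kernelTerm α z p‖)
    (F := fun (p : ℕ × ℕ) (θ : ℝ) => kernelTerm α (z * Complex.exp (-(θ * Complex.I))) p *
      f (ρ * Complex.exp (θ * Complex.I)))
    (f := fun θ : ℝ => 1 / (1 - z * Complex.exp (-(θ * Complex.I))) *
      (1 / (1 - (starRingEnd ℂ) (z * Complex.exp (-(θ * Complex.I)))) ^ ((α : ℂ) + 1)) *
      f (ρ * Complex.exp (θ * Complex.I)))
    (fun p => by
      refine Continuous.aestronglyMeasurable ?_
      simp only [kernelTerm_mul_exp]
      exact Continuous.mul (by fun_prop) (hf.continuous_comp_circle hρ))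
    (fun p => Eventually.of_forall fun θ _ => by
      rw [norm_mul, norm_kernelTerm_rotate _ _ _ (norm_exp_neg_mul_I θ)]
      exact mul_le_of_le_one_right (norm_nonneg _) (hbd _ (ofReal_mul_exp_mem_ball hρ θ)))
    (Eventually.of_forall fun θ _ => summable_norm_kernelTerm α hz)
    intervalIntegrable_const
    (Eventually.of_forall fun θ _ =>
      (hasSum_kernelTerm α (by rw [hzn]; exact hz)).mul_right _)
  have e : ∀ p : ℕ × ℕ, kernelTerm α z p * circleCoeff f ((p.1 : ℤ) - p.2) ρ =
      (2 * Real.pi : ℂ)⁻¹ * ∫ θ in (0 : ℝ)..2 * Real.pi,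
        kernelTerm α (z * Complex.exp (-(θ * Complex.I))) p *
          f (ρ * Complex.exp (θ * Complex.I)) := fun p => by
    rw [circleCoeff, mul_left_comm, ← intervalIntegral.integral_const_mul]
    congr 1
    refine intervalIntegral.integral_congr fun θ _ => ?_
    simp only [kernelTerm_mul_exp]
    ring
  simp only [e]
  rw [tsum_mul_left, h.tsum_eq, mul_left_comm]
  congr 1
  rw [← intervalIntegral.integral_const_mul]
  refine intervalIntegral.integral_congr fun θ _ => ?_
  simp only [alphaPoissonKernel, hzn]
  ring

/-- Poisson representation of a bounded `α`-harmonic function by its values on interior circles. -/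
lemma tendsto_alphaPoissonKernel_mean {α : ℝ} (hα : -1 < α) {f : ℂ → ℂ} (hf : IsAlphaHarmonic α f)
    (hbd : ∀ z ∈ Metric.ball (0 : ℂ) 1, ‖f z‖ ≤ 1) {z : ℂ} (hz : ‖z‖ < 1) (hz0 : z ≠ 0) :
    Tendsto (fun ρ : ℝ => (2 * Real.pi : ℂ)⁻¹ * ∫ θ in (0 : ℝ)..2 * Real.pi,
      alphaPoissonKernel α (z * Complex.exp (-(θ * Complex.I))) *
        f (ρ * Complex.exp (θ * Complex.I))) (𝓝[<] 1) (𝓝 (f z)) := by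
  obtain ⟨c, hc, hlim, hpos, hneg⟩ := exists_boundary_coeff hα hf hbd
  have hev : ∀ᶠ ρ : ℝ in 𝓝[<] 1, ρ ∈ Ioo (0 : ℝ) 1 := Ioo_mem_nhdsLT one_pos
  have hr : ‖z‖ ∈ Ioo (0 : ℝ) 1 := ⟨norm_pos_iff.2 hz0, hz⟩
  have h1 := hasSum_circleCoeff_mul_exp hc hpos hneg hr z.arg
  have h2 := eq_series_of_continuousOn hf.1.continuousOn (abs_lt_one_of_mem_Ioo hr) z.arg h1
  rw [Complex.norm_mul_exp_arg_mul_I] at h2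
  rw [← h2]
  have h3 : Tendsto (fun ρ : ℝ => ∑' p : ℕ × ℕ, kernelTerm α z p * circleCoeff f ((p.1 : ℤ) - p.2) ρ)
      (𝓝[<] 1) (𝓝 (∑' p : ℕ × ℕ, kernelTerm α z p * c ((p.1 : ℤ) - p.2))) := by
    refine tendsto_tsum_of_dominated_convergence (summable_norm_kernelTerm α hz)
      (fun p => (hlim _).const_mul _) ?_
    filter_upwards [hev] with ρ hρ p
    rw [norm_mul]
    exact mul_le_of_le_one_right (norm_nonneg _)
      (norm_circleCoeff_le hbd _ (abs_lt_one_of_mem_Ioo hρ))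
  refine (h3.const_mul _).congr' ?_
  filter_upwards [hev] with ρ hρ
  exact (alphaPoissonKernel_mean α hf.1.continuousOn hbd hz (abs_lt_one_of_mem_Ioo hρ)).symm

/-- Mean value property: mode `0` is constant in the radius, and its value is found by letting the
radius tend to `0`. -/
lemma circleCoeff_zero_eq {α : ℝ} {f : ℂ → ℂ} (hf : IsAlphaHarmonic α f) {ρ : ℝ}
    (hρ : ρ ∈ Ioo (0 : ℝ) 1) : circleCoeff f 0 ρ = f 0 := by
  obtain ⟨c, hc⟩ := circleCoeff_natCast hf 0
  have hf1 : ContDiffOn ℝ 1 f (Metric.ball 0 1) := hf.1.of_le (by norm_num)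
  simp only [Nat.cast_zero, pow_zero, mul_one] at hc
  rw [hc ρ hρ, ← circleCoeff_zero_radius f]
  refine tendsto_nhds_unique (tendsto_const_nhds.congr' ?_) (tendsto_circleCoeff_zero hf1 0)
  filter_upwards [eventually_mem_Ioo_nhdsGT_zero] with x hx using (hc x hx).symm

/-! ### Deviation of the power factor from `1`. -/

/-- Both sides, with `v` replaced by `t v`, vanish at `t = 0`, so it suffices to compare derivatives
on `[0, 1]`. There `|1 - t v| ≥ 1 - t|v|`, and the exponent `-α - 1` is negative because `α > -1`.
The number `σ` plays the role of the sign of `α`. -/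
lemma norm_one_sub_cpow_sub_one_le {α : ℝ} (hα : -1 < α) {σ : ℝ} (hσ : σ * α = |α|) {v : ℂ}
    (hv : ‖v‖ < 1) :
    ‖(1 - v) ^ ((-α : ℝ) : ℂ) - 1‖ ≤ σ * ((1 - ‖v‖) ^ (-α) - 1) := by
  have hlow : ∀ t ∈ Icc (0 : ℝ) 1, 0 < 1 - t * ‖v‖ := fun t ht => by
    nlinarith [norm_nonneg v, ht.1, ht.2]
  have hnorm : ∀ t ∈ Icc (0 : ℝ) 1, 1 - t * ‖v‖ ≤ ‖1 - (t : ℂ) * v‖ := fun t ht => by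
    have := norm_sub_norm_le (1 : ℂ) ((t : ℂ) * v)
    simpa [abs_of_nonneg ht.1] using this
  have hslit : ∀ t ∈ Icc (0 : ℝ) 1, 1 - (t : ℂ) * v ∈ Complex.slitPlane := fun t ht => by
    refine Or.inl ?_
    have h1 : ((t : ℂ) * v).re ≤ t * ‖v‖ := by
      rw [Complex.re_ofReal_mul]
      exact mul_le_mul_of_nonneg_left (Complex.re_le_norm v) ht.1
    have h2 := hlow t ht
    rw [Complex.sub_re, Complex.one_re]
    linarith
  have hF : ∀ t ∈ Icc (0 : ℝ) 1, HasDerivAt (fun t : ℝ => (1 - (t : ℂ) * v) ^ ((-α : ℝ) : ℂ) - 1)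
      (((-α : ℝ) : ℂ) * (1 - (t : ℂ) * v) ^ (((-α : ℝ) : ℂ) - 1) * (-v)) t := fun t ht => by
    have h0 : HasDerivAt (fun t : ℝ => (t : ℂ)) 1 t := Complex.ofRealCLM.hasDerivAt
    have h1 : HasDerivAt (fun t : ℝ => 1 - (t : ℂ) * v) (-v) t := by
      simpa using (h0.mul_const v).const_sub 1
    have h2 : HasDerivAt (fun x : ℂ => x ^ ((-α : ℝ) : ℂ))
        (((-α : ℝ) : ℂ) * (1 - (t : ℂ) * v) ^ (((-α : ℝ) : ℂ) - 1)) (1 - (t : ℂ) * v) := by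
      simpa using (hasDerivAt_id (1 - (t : ℂ) * v)).cpow_const (c := ((-α : ℝ) : ℂ)) (hslit t ht)
    exact (h2.comp t h1).sub_const 1
  have hB : ∀ t ∈ Icc (0 : ℝ) 1, HasDerivAt (fun t : ℝ => σ * ((1 - t * ‖v‖) ^ (-α) - 1))
      (σ * (α * ‖v‖ * (1 - t * ‖v‖) ^ (-α - 1))) t := fun t ht => by
    have h1 : HasDerivAt (fun t : ℝ => 1 - t * ‖v‖) (-‖v‖) t := by
      simpa using ((hasDerivAt_id t).mul_const ‖v‖).const_sub 1
    refine (((h1.rpow_const (p := -α) (Or.inl (hlow t ht).ne')).sub_const 1).const_mul σ).congr_deriv ?_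
    ring
  have key := image_norm_le_of_norm_deriv_right_le_deriv_boundary' (a := (0 : ℝ)) (b := 1)
    (fun t ht => (hF t ht).continuousAt.continuousWithinAt)
    (fun t ht => (hF t (Ico_subset_Icc_self ht)).hasDerivWithinAt)
    (B := fun t : ℝ => σ * ((1 - t * ‖v‖) ^ (-α) - 1)) (by simp)
    (fun t ht => (hB t ht).continuousAt.continuousWithinAt)
    (fun t ht => (hB t (Ico_subset_Icc_self ht)).hasDerivWithinAt)
    (fun t ht => by
      have ht' := Ico_subset_Icc_self ht
      have e : ((-α : ℝ) : ℂ) - 1 = ((-α - 1 : ℝ) : ℂ) := by push_cast; ring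
      rw [e, norm_mul, norm_mul, norm_neg, Complex.norm_cpow_real, Complex.norm_real,
        Real.norm_eq_abs, abs_neg]
      have h1 : ‖1 - (t : ℂ) * v‖ ^ (-α - 1) ≤ (1 - t * ‖v‖) ^ (-α - 1) :=
        Real.rpow_le_rpow_of_nonpos (hlow t ht') (hnorm t ht') (by linarith)
      calc |α| * ‖1 - (t : ℂ) * v‖ ^ (-α - 1) * ‖v‖
          ≤ |α| * (1 - t * ‖v‖) ^ (-α - 1) * ‖v‖ := by gcongr
        _ = σ * (α * ‖v‖ * (1 - t * ‖v‖) ^ (-α - 1)) := by rw [← hσ]; ring)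
    (right_mem_Icc.2 zero_le_one)
  simpa using key

/-! ### The `L¹` distance of the classical Poisson kernel from its value at `±π/2`. -/

/-- The classical Poisson kernel of the disc at radius `r` and angle `φ`. -/
noncomputable def poissonAngle (r φ : ℝ) : ℝ := (1 - r ^ 2) / (1 - 2 * r * Real.cos φ + r ^ 2)

lemma poissonAngle_denom_pos {r : ℝ} (h0 : 0 ≤ r) (h1 : r < 1) (φ : ℝ) :
    0 < 1 - 2 * r * Real.cos φ + r ^ 2 := by
  nlinarith [Real.cos_le_one φ, mul_nonneg h0 (sub_nonneg.2 (Real.cos_le_one φ))]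

lemma continuous_poissonAngle {r : ℝ} (h0 : 0 ≤ r) (h1 : r < 1) : Continuous (poissonAngle r) :=
  continuous_const.div (by fun_prop) fun φ => (poissonAngle_denom_pos h0 h1 φ).ne'

lemma hasDerivAt_poissonAngle_primitive {r : ℝ} (h0 : 0 ≤ r) (h1 : r < 1) (φ : ℝ) :
    HasDerivAt (fun φ => φ + 2 * Real.arctan (r * Real.sin φ / (1 - r * Real.cos φ)))
      (poissonAngle r φ) φ := by
  have hd : 0 < 1 - r * Real.cos φ := by
    nlinarith [Real.cos_le_one φ, mul_nonneg h0 (sub_nonneg.2 (Real.cos_le_one φ))]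
  have hD := poissonAngle_denom_pos h0 h1 φ
  have hs := ((Real.hasDerivAt_sin φ).const_mul r)
  have hc := ((Real.hasDerivAt_cos φ).const_mul r).const_sub 1
  refine ((hasDerivAt_id φ).add (((hs.div hc hd.ne').arctan).const_mul 2)).congr_deriv ?_
  have hsc := Real.sin_sq_add_cos_sq φ
  have e : 1 + (r * Real.sin φ / (1 - r * Real.cos φ)) ^ 2 =
      (1 - 2 * r * Real.cos φ + r ^ 2) / (1 - r * Real.cos φ) ^ 2 := by
    field_simp
    linear_combination r ^ 2 * hsc
  simp only [Pi.div_apply]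
  rw [e, poissonAngle]
  field_simp
  linear_combination (-2 * r ^ 2) * hsc

lemma integral_poissonAngle {r : ℝ} (h0 : 0 ≤ r) (h1 : r < 1) (a b : ℝ) :
    ∫ φ in a..b, poissonAngle r φ =
      (b + 2 * Real.arctan (r * Real.sin b / (1 - r * Real.cos b))) -
        (a + 2 * Real.arctan (r * Real.sin a / (1 - r * Real.cos a))) :=
  intervalIntegral.integral_eq_sub_of_hasDerivAt
    (fun φ _ => hasDerivAt_poissonAngle_primitive h0 h1 φ)
    ((continuous_poissonAngle h0 h1).intervalIntegrable _ _)

lemma poissonAngle_sub {r : ℝ} (h0 : 0 ≤ r) (h1 : r < 1) (φ : ℝ) :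
    poissonAngle r φ - (1 - r ^ 2) / (1 + r ^ 2) =
      (1 - r ^ 2) * (2 * r * Real.cos φ) / ((1 - 2 * r * Real.cos φ + r ^ 2) * (1 + r ^ 2)) := by
  have hD := poissonAngle_denom_pos h0 h1 φ
  rw [poissonAngle, div_sub_div _ _ hD.ne' (by positivity : 1 + r ^ 2 ≠ 0)]
  congr 1
  ring

/-- The difference has the sign of `cos φ`. Starting the period at `-π/2` leaves one sign change, at
`π/2`; the explicit primitive evaluates both halves, and the linear terms cancel. -/
lemma integral_abs_poissonAngle_sub_shifted {r : ℝ} (h0 : 0 ≤ r) (h1 : r < 1) :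
    ∫ φ in (-(Real.pi / 2))..(3 * Real.pi / 2), |poissonAngle r φ - (1 - r ^ 2) / (1 + r ^ 2)| =
      8 * Real.arctan r := by
  have hpi := Real.pi_pos
  have hcont := continuous_poissonAngle h0 h1
  have hr2 : 0 ≤ 1 - r ^ 2 := by nlinarith
  have hint : ∀ a b, IntervalIntegrable
      (fun φ => |poissonAngle r φ - (1 - r ^ 2) / (1 + r ^ 2)|) volume a b :=
    fun a b => (hcont.sub continuous_const).abs.intervalIntegrable _ _
  have hs : Real.sin (3 * Real.pi / 2) = -1 := by
    rw [show 3 * Real.pi / 2 = Real.pi / 2 + Real.pi by ring, Real.sin_add_pi, Real.sin_pi_div_two]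
  have hc : Real.cos (3 * Real.pi / 2) = 0 := by
    rw [show 3 * Real.pi / 2 = Real.pi / 2 + Real.pi by ring, Real.cos_add_pi, Real.cos_pi_div_two,
      neg_zero]
  rw [← intervalIntegral.integral_add_adjacent_intervals (hint _ (Real.pi / 2)) (hint _ _)]
  have hA : ∫ φ in (-(Real.pi / 2))..(Real.pi / 2),
      |poissonAngle r φ - (1 - r ^ 2) / (1 + r ^ 2)| =
      ∫ φ in (-(Real.pi / 2))..(Real.pi / 2), (poissonAngle r φ - (1 - r ^ 2) / (1 + r ^ 2)) := by
    refine intervalIntegral.integral_congr fun φ hφ => ?_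
    rw [uIcc_of_le (by linarith)] at hφ
    have hcos := Real.cos_nonneg_of_mem_Icc hφ
    have hD := poissonAngle_denom_pos h0 h1 φ
    simp only [poissonAngle_sub h0 h1]
    exact abs_of_nonneg (by positivity)
  have hB : ∫ φ in (Real.pi / 2)..(3 * Real.pi / 2),
      |poissonAngle r φ - (1 - r ^ 2) / (1 + r ^ 2)| =
      ∫ φ in (Real.pi / 2)..(3 * Real.pi / 2), -(poissonAngle r φ - (1 - r ^ 2) / (1 + r ^ 2)) := by
    refine intervalIntegral.integral_congr fun φ hφ => ?_
    rw [uIcc_of_le (by linarith)] at hφ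
    have hcos := Real.cos_nonpos_of_pi_div_two_le_of_le hφ.1 (by linarith [hφ.2])
    have hD := poissonAngle_denom_pos h0 h1 φ
    simp only [poissonAngle_sub h0 h1]
    refine abs_of_nonpos (div_nonpos_of_nonpos_of_nonneg ?_ (by positivity))
    exact mul_nonpos_of_nonneg_of_nonpos hr2 (mul_nonpos_of_nonneg_of_nonpos (by positivity) hcos)
  have hPi : ∀ a b, IntervalIntegrable (poissonAngle r) volume a b :=
    fun a b => hcont.intervalIntegrable _ _
  rw [hA, hB, intervalIntegral.integral_neg,
    intervalIntegral.integral_sub (hPi _ _) intervalIntegrable_const,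
    intervalIntegral.integral_sub (hPi _ _) intervalIntegrable_const,
    integral_poissonAngle h0 h1, integral_poissonAngle h0 h1]
  simp only [intervalIntegral.integral_const, smul_eq_mul, hs, hc, Real.sin_neg, Real.cos_neg,
    Real.sin_pi_div_two, Real.cos_pi_div_two]
  simp only [mul_zero, sub_zero, mul_one, mul_neg, div_one, Real.arctan_neg]
  ring

lemma integral_abs_poissonAngle_sub {r : ℝ} (h0 : 0 ≤ r) (h1 : r < 1) (t : ℝ) :
    ∫ θ in (0 : ℝ)..2 * Real.pi, |poissonAngle r (t - θ) - (1 - r ^ 2) / (1 + r ^ 2)| =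
      8 * Real.arctan r := by
  have hper : Function.Periodic (fun φ => |poissonAngle r φ - (1 - r ^ 2) / (1 + r ^ 2)|)
      (2 * Real.pi) := fun φ => by simp [poissonAngle]
  rw [intervalIntegral.integral_comp_sub_left
    (fun φ => |poissonAngle r φ - (1 - r ^ 2) / (1 + r ^ 2)|) t,
    ← integral_abs_poissonAngle_sub_shifted h0 h1]
  have h := hper.intervalIntegral_add_eq (t - 2 * Real.pi) (-(Real.pi / 2))
  rw [sub_zero]
  convert h using 2 <;> ring

/-! ### The kernel estimate and the resulting inequality. -/

lemma norm_sq_one_sub_mul_exp (r φ : ℝ) :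
    Complex.normSq (1 - r * Complex.exp (φ * Complex.I)) = 1 - 2 * r * Real.cos φ + r ^ 2 := by
  simp only [Complex.normSq_apply, Complex.sub_re, Complex.one_re, Complex.re_ofReal_mul,
    Complex.exp_ofReal_mul_I_re, Complex.sub_im, Complex.one_im, Complex.im_ofReal_mul,
    Complex.exp_ofReal_mul_I_im]
  linear_combination r ^ 2 * Real.sin_sq_add_cos_sq φ

/-- From `P_α = (1 - r²)^α (1 - conj w)^(-α) P`, adding and subtracting `q (1 - conj w)^(-α)`
separates the classical oscillation from the deviation of the power. -/
lemma alphaPoissonKernel_sub_eq (α : ℝ) {r : ℝ} (h0 : 0 ≤ r) (h1 : r < 1) (φ : ℝ) {w : ℂ}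
    (hw : w = r * Complex.exp (φ * Complex.I)) :
    alphaPoissonKernel α w - (((1 - r ^ 2) ^ (α + 1) / (1 + r ^ 2) : ℝ) : ℂ) =
      (((1 - r ^ 2) ^ α : ℝ) : ℂ) *
        ((1 - (starRingEnd ℂ) w) ^ ((-α : ℝ) : ℂ) *
            ((poissonAngle r φ - (1 - r ^ 2) / (1 + r ^ 2) : ℝ) : ℂ) +
          (((1 - r ^ 2) / (1 + r ^ 2) : ℝ) : ℂ) *
            ((1 - (starRingEnd ℂ) w) ^ ((-α : ℝ) : ℂ) - 1)) := by
  have hwn : ‖w‖ = r := by rw [hw, norm_ofReal_mul_exp, abs_of_nonneg h0]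
  have hr2 : 0 < 1 - r ^ 2 := by nlinarith
  have hn1 : 1 - w ≠ 0 := fun h => by
    rw [sub_eq_zero.1 h |>.symm, norm_one] at hwn; linarith
  have hn2 : 1 - (starRingEnd ℂ) w ≠ 0 := fun h => hn1 (by
    have := congrArg (starRingEnd ℂ) h
    simpa using this)
  have hP : (poissonAngle r φ : ℂ) = ((1 - r ^ 2 : ℝ) : ℂ) / ((1 - w) * (1 - (starRingEnd ℂ) w)) := by
    have e : (1 - w) * (1 - (starRingEnd ℂ) w) = ((1 - 2 * r * Real.cos φ + r ^ 2 : ℝ) : ℂ) := by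
      rw [← norm_sq_one_sub_mul_exp, ← hw, ← Complex.mul_conj, map_sub, map_one]
    rw [e, poissonAngle, Complex.ofReal_div]
  have hpow : (1 - (starRingEnd ℂ) w) ^ ((α : ℂ) + 1) =
      ((1 - (starRingEnd ℂ) w) ^ ((-α : ℝ) : ℂ))⁻¹ * (1 - (starRingEnd ℂ) w) := by
    rw [Complex.cpow_add _ _ hn2, Complex.cpow_one, ← Complex.cpow_neg, Complex.ofReal_neg, neg_neg]
  have hW : (1 - r ^ 2) ^ (α + 1) = (1 - r ^ 2) ^ α * (1 - r ^ 2) := by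
    rw [Real.rpow_add hr2, Real.rpow_one]
  rw [alphaPoissonKernel, hwn, hpow, hW, mul_div_assoc, Complex.ofReal_sub, hP]
  simp only [Complex.ofReal_mul, mul_inv, inv_inv, div_eq_mul_inv]
  ring

lemma norm_alphaPoissonKernel_sub_le (α : ℝ) {S D r : ℝ} (h0 : 0 ≤ r) (h1 : r < 1)
    (hS : ∀ v : ℂ, ‖v‖ = r → ‖(1 - v) ^ ((-α : ℝ) : ℂ)‖ ≤ S)
    (hD : ∀ v : ℂ, ‖v‖ = r → ‖(1 - v) ^ ((-α : ℝ) : ℂ) - 1‖ ≤ D) (φ : ℝ) {w : ℂ}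
    (hw : w = r * Complex.exp (φ * Complex.I)) :
    ‖alphaPoissonKernel α w - (((1 - r ^ 2) ^ (α + 1) / (1 + r ^ 2) : ℝ) : ℂ)‖ ≤
      (1 - r ^ 2) ^ α * (S * |poissonAngle r φ - (1 - r ^ 2) / (1 + r ^ 2)| +
        (1 - r ^ 2) / (1 + r ^ 2) * D) := by
  have hr2 : 0 < 1 - r ^ 2 := by nlinarith
  have hW := Real.rpow_pos_of_pos hr2 α
  have hwn : ‖(starRingEnd ℂ) w‖ = r := by
    rw [RCLike.norm_conj, hw, norm_ofReal_mul_exp, abs_of_nonneg h0]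
  rw [alphaPoissonKernel_sub_eq α h0 h1 φ hw, norm_mul, Complex.norm_real, Real.norm_eq_abs,
    abs_of_pos hW]
  refine mul_le_mul_of_nonneg_left ((norm_add_le _ _).trans (add_le_add ?_ ?_)) hW.le
  · rw [norm_mul, Complex.norm_real, Real.norm_eq_abs]
    exact mul_le_mul_of_nonneg_right (hS _ hwn) (abs_nonneg _)
  · rw [norm_mul, Complex.norm_real, Real.norm_eq_abs,
      abs_of_pos (div_pos hr2 (by positivity : 0 < 1 + r ^ 2))]
    exact mul_le_mul_of_nonneg_left (hD _ hwn) (by positivity)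

lemma continuous_alphaPoissonKernel_circle (α : ℝ) {z : ℂ} (hz : ‖z‖ < 1) :
    Continuous fun θ : ℝ => alphaPoissonKernel α (z * Complex.exp (-(θ * Complex.I))) := by
  have hzn : ∀ θ : ℝ, ‖z * Complex.exp (-(θ * Complex.I))‖ = ‖z‖ := fun θ => by
    rw [norm_mul, norm_exp_neg_mul_I, mul_one]
  have hre : ∀ θ : ℝ, 0 < (1 - z * Complex.exp (-(θ * Complex.I))).re := fun θ => by
    have := Complex.re_le_norm (z * Complex.exp (-(θ * Complex.I)))
    rw [hzn] at this
    rw [Complex.sub_re, Complex.one_re]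
    linarith
  have hre' : ∀ θ : ℝ, 0 < (1 - (starRingEnd ℂ) (z * Complex.exp (-(θ * Complex.I)))).re := fun θ => by
    simpa using hre θ
  have hne : ∀ x : ℂ, 0 < x.re → x ≠ 0 := fun x hx h => by simp [h] at hx
  simp only [alphaPoissonKernel, hzn]
  refine continuous_const.mul ((continuous_const.div (by fun_prop) fun θ => hne _ (hre θ)).mul
    (continuous_const.div (Continuous.cpow ?_ continuous_const fun θ => Or.inl (hre' θ))
      fun θ => ?_))
  · exact continuous_const.sub (Complex.continuous_conj.comp (by fun_prop))
  · rw [Complex.cpow_ne_zero_iff]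
    exact Or.inl (hne _ (hre' θ))

/-- The Heinz-type inequality for `α`-harmonic functions, in terms of bounds for `(1 - v) ^ (-α)`. -/
lemma norm_sub_le_of_bounds {α : ℝ} (hα : -1 < α) {f : ℂ → ℂ} (hf : IsAlphaHarmonic α f)
    (hbd : ∀ z ∈ Metric.ball (0 : ℂ) 1, ‖f z‖ ≤ 1) {z : ℂ} (hz : ‖z‖ < 1) (hz0 : z ≠ 0) {S D : ℝ}
    (hS : ∀ v : ℂ, ‖v‖ = ‖z‖ → ‖(1 - v) ^ ((-α : ℝ) : ℂ)‖ ≤ S)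
    (hD : ∀ v : ℂ, ‖v‖ = ‖z‖ → ‖(1 - v) ^ ((-α : ℝ) : ℂ) - 1‖ ≤ D) :
    ‖f z - (((1 - ‖z‖ ^ 2) ^ (α + 1) / (1 + ‖z‖ ^ 2) : ℝ) : ℂ) * f 0‖ ≤
      (1 - ‖z‖ ^ 2) ^ α * (S * (4 / Real.pi * Real.arctan ‖z‖) +
        (1 - ‖z‖ ^ 2) / (1 + ‖z‖ ^ 2) * D) := by
  set r := ‖z‖ with hr
  set κ : ℂ := (((1 - r ^ 2) ^ (α + 1) / (1 + r ^ 2) : ℝ) : ℂ) with hκ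
  have h0 : 0 ≤ r := norm_nonneg z
  refine le_of_tendsto ((tendsto_alphaPoissonKernel_mean hα hf hbd hz hz0).sub_const
    (κ * f 0)).norm ?_
  filter_upwards [(Ioo_mem_nhdsLT one_pos : Ioo (0 : ℝ) 1 ∈ 𝓝[<] 1)] with ρ hρ
  have hfc := hf.1.continuousOn.continuous_comp_circle (abs_lt_one_of_mem_Ioo hρ)
  have hKc := continuous_alphaPoissonKernel_circle α hz
  -- Taking the mean over the same circle of radius `ρ` puts the whole difference under one
  -- integral, with `P_α - κ` as the only kernel.
  have hzero : κ * f 0 = (2 * Real.pi : ℂ)⁻¹ * ∫ θ in (0 : ℝ)..2 * Real.pi,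
      κ * f (ρ * Complex.exp (θ * Complex.I)) := by
    rw [← circleCoeff_zero_eq hf hρ, circleCoeff, intervalIntegral.integral_const_mul]
    simp only [Int.cast_zero, zero_mul, neg_zero, Complex.exp_zero, mul_one]
    ring
  have hKf : IntervalIntegrable (fun θ : ℝ => alphaPoissonKernel α
      (z * Complex.exp (-(θ * Complex.I))) * f (ρ * Complex.exp (θ * Complex.I)))
      volume 0 (2 * Real.pi) := (hKc.mul hfc).intervalIntegrable _ _
  have hκf : IntervalIntegrable (fun θ : ℝ => κ * f (ρ * Complex.exp (θ * Complex.I)))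
      volume 0 (2 * Real.pi) := (continuous_const.mul hfc).intervalIntegrable _ _
  rw [hzero, ← mul_sub, ← intervalIntegral.integral_sub hKf hκf, norm_mul]
  have hP : Continuous fun θ : ℝ => |poissonAngle r (z.arg - θ) - (1 - r ^ 2) / (1 + r ^ 2)| :=
    (((continuous_poissonAngle h0 hz).comp (by fun_prop : Continuous fun θ : ℝ => z.arg - θ)).sub
      continuous_const).abs
  have hbound : ‖∫ θ in (0 : ℝ)..2 * Real.pi,
      (alphaPoissonKernel α (z * Complex.exp (-(θ * Complex.I))) *
        f (ρ * Complex.exp (θ * Complex.I)) - κ * f (ρ * Complex.exp (θ * Complex.I)))‖ ≤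
      ∫ θ in (0 : ℝ)..2 * Real.pi, (1 - r ^ 2) ^ α *
        (S * |poissonAngle r (z.arg - θ) - (1 - r ^ 2) / (1 + r ^ 2)| +
          (1 - r ^ 2) / (1 + r ^ 2) * D) := by
    refine intervalIntegral.norm_integral_le_of_norm_le (by positivity)
      (Eventually.of_forall fun θ _ => ?_) ?_
    · rw [← sub_mul, norm_mul]
      refine (mul_le_of_le_one_right (norm_nonneg _)
        (hbd _ (ofReal_mul_exp_mem_ball (abs_lt_one_of_mem_Ioo hρ) θ))).trans ?_
      refine norm_alphaPoissonKernel_sub_le α h0 hz hS hD _ ?_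
      conv_lhs => rw [← Complex.norm_mul_exp_arg_mul_I z]
      rw [mul_assoc, ← Complex.exp_add]
      congr 2
      push_cast
      ring
    · exact (continuous_const.mul
        ((continuous_const.mul hP).add continuous_const)).intervalIntegrable _ _
  have hpi := Real.pi_pos
  have hn : ‖(2 * Real.pi : ℂ)⁻¹‖ = (2 * Real.pi)⁻¹ := by
    simp [abs_of_pos hpi]
  rw [hn]
  refine (mul_le_mul_of_nonneg_left hbound (by positivity)).trans (le_of_eq ?_)
  have hSP : IntervalIntegrable
      (fun θ : ℝ => S * |poissonAngle r (z.arg - θ) - (1 - r ^ 2) / (1 + r ^ 2)|)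
      volume 0 (2 * Real.pi) := (continuous_const.mul hP).intervalIntegrable _ _
  rw [intervalIntegral.integral_const_mul, intervalIntegral.integral_add hSP
    intervalIntegrable_const, intervalIntegral.integral_const_mul,
    integral_abs_poissonAngle_sub h0 hz, intervalIntegral.integral_const, smul_eq_mul]
  field_simp
  ring

theorem theorem3p3 (α : ℝ) (hα : -1 < α) (f : ℂ → ℂ) (hf : IsAlphaHarmonic α f)
    (hmaps : Set.MapsTo f (Metric.ball 0 1) (Metric.ball 0 1)) :
    (0 ≤ α → ∀ z ∈ Metric.ball (0 : ℂ) 1,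
      ‖f z - (((1 - ‖z‖ ^ 2) ^ (α + 1) / (1 + ‖z‖ ^ 2) : ℝ) : ℂ) * f 0‖ ≤
        (2 : ℝ) ^ (α + 2) / Real.pi * Real.arctan ‖z‖ +
          (2 : ℝ) ^ (α + 1) * (1 - ‖z‖) * (1 - (1 - ‖z‖) ^ α)) ∧
    (α < 0 → ∀ z ∈ Metric.ball (0 : ℂ) 1,
      ‖f z - (((1 - ‖z‖ ^ 2) ^ (α + 1) / (1 + ‖z‖ ^ 2) : ℝ) : ℂ) * f 0‖ ≤
        4 / Real.pi * (1 - ‖z‖) ^ α * Real.arctan ‖z‖ + ((1 - ‖z‖) ^ α - 1)) := by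
  have hbd : ∀ z ∈ Metric.ball (0 : ℂ) 1, ‖f z‖ ≤ 1 := fun z hz => by
    have := hmaps hz
    rw [mem_ball_zero_iff] at this
    exact this.le
  have hpi := Real.pi_pos
  constructor
  · intro hα0 z hz
    rw [mem_ball_zero_iff] at hz
    -- The Poisson representation was derived on circles of positive radius; at the centre both
    -- sides are `0`.
    rcases eq_or_ne z 0 with rfl | hz0
    · simp
    -- For `α ≥ 0` the power is largest where `|1 - v|` is smallest. This `S` cancels the factor `(1
    -- - r)^α` of `(1 - r²)^α`, leaving `(1 + r)^α ≤ 2^α`.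
    have h := norm_sub_le_of_bounds hα hf hbd hz hz0 (S := (1 - ‖z‖) ^ (-α))
      (D := (1 - ‖z‖) ^ (-α) - 1)
      (fun v hv => by
        rw [Complex.norm_cpow_real]
        refine Real.rpow_le_rpow_of_nonpos (by linarith) ?_ (by linarith)
        have := norm_sub_norm_le (1 : ℂ) v
        rwa [norm_one, hv] at this)
      (fun v hv => by
        have := norm_one_sub_cpow_sub_one_le hα (σ := 1) (by rw [one_mul, abs_of_nonneg hα0])
          (v := v) (by rwa [hv])
        rwa [hv, one_mul] at this)
    refine h.trans ?_
    have hr0 : 0 ≤ ‖z‖ := norm_nonneg z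
    generalize ‖z‖ = r at hz hr0
    have hA : 0 ≤ Real.arctan r := Real.arctan_nonneg.2 hr0
    have h1r : 0 < 1 - r := by linarith
    have hX := Real.rpow_pos_of_pos h1r α
    have hX1 : (1 - r) ^ α ≤ 1 := Real.rpow_le_one h1r.le (by linarith) hα0
    have hY : (1 + r) ^ α ≤ 2 ^ α := Real.rpow_le_rpow (by linarith) (by linarith) hα0
    have hY0 : 0 < (1 + r) ^ α := Real.rpow_pos_of_pos (by linarith) α
    have hq : (1 - r ^ 2) / (1 + r ^ 2) ≤ 2 * (1 - r) := by
      rw [div_le_iff₀ (by positivity)]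
      nlinarith [mul_nonneg h1r.le (sq_nonneg r)]
    have hq0 : 0 ≤ (1 - r ^ 2) / (1 + r ^ 2) := div_nonneg (by nlinarith) (by positivity)
    have e : (1 - r ^ 2) ^ α = (1 - r) ^ α * (1 + r) ^ α := by
      rw [← Real.mul_rpow h1r.le (by linarith)]; ring_nf
    rw [e, Real.rpow_neg h1r.le, Real.rpow_add two_pos, Real.rpow_add two_pos, Real.rpow_one,
      Real.rpow_two]
    generalize (1 - r ^ 2) / (1 + r ^ 2) = q at hq hq0
    calc (1 - r) ^ α * (1 + r) ^ α * (((1 - r) ^ α)⁻¹ * (4 / Real.pi * Real.arctan r) +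
          q * (((1 - r) ^ α)⁻¹ - 1))
        = (1 + r) ^ α * (4 / Real.pi * Real.arctan r) +
          (1 + r) ^ α * q * (1 - (1 - r) ^ α) := by field_simp
      _ ≤ 2 ^ α * (4 / Real.pi * Real.arctan r) +
          2 ^ α * (2 * (1 - r)) * (1 - (1 - r) ^ α) := by
        have : 0 ≤ 1 - (1 - r) ^ α := by linarith
        gcongr
      _ = _ := by ring
  · intro hα0 z hz
    rw [mem_ball_zero_iff] at hz
    rcases eq_or_ne z 0 with rfl | hz0
    · simp
    -- For `α < 0` the exponent `-α` is positive, so `|1 - v| ≤ 1 + r` is the relevant bound. This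
    -- `S` cancels the factor `(1 + r)^α` instead, leaving `(1 - r)^α`.
    have h := norm_sub_le_of_bounds hα hf hbd hz hz0 (S := (1 + ‖z‖) ^ (-α))
      (D := 1 - (1 - ‖z‖) ^ (-α))
      (fun v hv => by
        rw [Complex.norm_cpow_real]
        refine Real.rpow_le_rpow (norm_nonneg _) ?_ (by linarith)
        have := norm_sub_le (1 : ℂ) v
        rwa [norm_one, hv] at this)
      (fun v hv => by
        have := norm_one_sub_cpow_sub_one_le hα (σ := -1) (by rw [abs_of_neg hα0]; ring)
          (v := v) (by rwa [hv])
        rw [hv] at this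
        linarith)
    refine h.trans ?_
    have hr0 : 0 ≤ ‖z‖ := norm_nonneg z
    generalize ‖z‖ = r at hz hr0
    have h1r : 0 < 1 - r := by linarith
    have h1r' : 0 < 1 + r := by linarith
    have hX := Real.rpow_pos_of_pos h1r α
    have hX1 : 1 ≤ (1 - r) ^ α := Real.one_le_rpow_of_pos_of_le_one_of_nonpos h1r (by linarith) hα0.le
    have hY : (1 + r) ^ α ≤ 1 := Real.rpow_le_one_of_one_le_of_nonpos (by linarith) hα0.le
    have hY0 : 0 < (1 + r) ^ α := Real.rpow_pos_of_pos h1r' α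
    have hq : (1 - r ^ 2) / (1 + r ^ 2) ≤ 1 := by
      rw [div_le_one (by positivity)]
      nlinarith [sq_nonneg r]
    have hq0 : 0 ≤ (1 - r ^ 2) / (1 + r ^ 2) := div_nonneg (by nlinarith) (by positivity)
    have e : (1 - r ^ 2) ^ α = (1 - r) ^ α * (1 + r) ^ α := by
      rw [← Real.mul_rpow h1r.le (by linarith)]; ring_nf
    rw [e, Real.rpow_neg h1r.le, Real.rpow_neg h1r'.le]
    generalize (1 - r ^ 2) / (1 + r ^ 2) = q at hq hq0
    calc (1 - r) ^ α * (1 + r) ^ α * (((1 + r) ^ α)⁻¹ * (4 / Real.pi * Real.arctan r) +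
          q * (1 - ((1 - r) ^ α)⁻¹))
        = (1 - r) ^ α * (4 / Real.pi * Real.arctan r) +
          (1 + r) ^ α * q * ((1 - r) ^ α - 1) := by field_simp
      _ ≤ (1 - r) ^ α * (4 / Real.pi * Real.arctan r) + ((1 - r) ^ α - 1) := by
        have h1 : (1 + r) ^ α * q ≤ 1 := mul_le_one₀ hY hq0 hq
        have h2 : 0 ≤ (1 - r) ^ α - 1 := by linarith
        exact add_le_add le_rfl (mul_le_of_le_one_left h2 h1)
      _ = _ := by ring
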